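/- Let $k$ be a commutative ring (for instance a field) and let $(H,\Delta,\epsilon,\phi,S,\alpha,\beta)$ be a quasi-Hopf algebra over $k$. That is: $H$ is a unital algebra; $\Delta:H\to H\otimes H$ and $\epsilon:H\to k$ are algebra maps; $\phi\in H^{\otimes 3}$ is invertible; $(\mathrm{id}\otimes\Delta)\Delta(h)=\phi\,\big((\Delta\otimes\mathrm{id})\Delta(h)\big)\,\phi^{-1}$; $(\epsilon\otimes\mathrm{id})\Delta=\mathrm{id}=(\mathrm{id}\otimes\epsilon)\Delta$; $(1\otimes\phi)\,\big((\mathrm{id}\otimes\Delta\otimes\mathrm{id})\phi\big)\,(\phi\otimes1)=\big((\mathrm{id}\otimes\mathrm{id}\otimes\Delta)\phi\big)\big((\Delta\otimes\mathrm{id}\otimes\mathrm{id})\phi\big)$; $(\mathrm{id}\otimes\epsilon\otimes\mathrm{id})\phi=1\otimes1$; and $S:H\to H$ is a $k$-linear unital algebra anti-homomorphism and $\alpha,\beta\in H$ are elements with $\sum S(h_{(1)})\alpha h_{(2)}=\epsilon(h)\alpha$, $\sum h_{(1)}\beta S(h_{(2)})=\epsilon(h)\beta$, $\sum\phi^{(1)}\beta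 S(\phi^{(2)})\alpha\phi^{(3)}=1$, $\sum S(\phi^{-(1)})\alpha\phi^{-(2)}\beta S(\phi^{-(3)})=1$. Here $\phi=\sum\phi^{(1)}\otimes\phi^{(2)}\otimes\phi^{(3)}$ and $\phi^{-1}=\sum\phi^{-(1)}\otimes\phi^{-(2)}\otimes\phi^{-(3)}$. Assume that $S$ is bijective. Let ${}_H\mathcal M$ be the monoidal category of left $H$-modules: $H$ acts on $V\otimes W$ through $\Delta$ and on the unit object $k$ through $\epsilon$, and the associator is $\Phi_{V,W,Z}((v\otimes w)\otimes z)=\sum\phi^{(1)}\triangleright v\otimes(\phi^{(2)}\triangleright w\otimes\phi^{(3)}\triangleright z)$. Let $({}_H\mathcal M)^\circ$ be its (Drinfeld) center. Its objects are pairs $(V,\lambda)$ with $V\in{}_H\mathcal M$ and $\lambda_W:V\otimes W\to W\otimes V$ isomorphisms, natural in $W$, with $\lambda_k=\mathrm{id}$ (up to unit isomorphisms) and $\lambda_Z\circ\Phi_{W,V,Z}\circ\lambda_W=\Phi_{W,Z,V}\circ\lambda_{W\otimes Z}\circ\Phi_{V,W,Z}$. A morphism $(V,\lambda)\to(V',\lambda')$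 is an $H$-module map $f:V\to V'$ with $(\mathrm{id}\otimes f)\lambda_Z=\lambda'_Z(f\otimes\mathrm{id})$ for all $Z$. The tensor product of $(V,\lambda^V)$ and $(W,\lambda^W)$ is $V\otimes W$ with $\lambda_Z=\Phi_{Z,V,W}\circ\lambda^V_Z\circ\Phi_{V,Z,W}^{-1}\circ\lambda^W_Z\circ\Phi_{V,W,Z}$, the associator is that of ${}_H\mathcal M$, and the braiding is $\Psi_{(V,\lambda^V),(W,\lambda^W)}=\lambda^V_W$. Write $H_L$ for $H$ with its left regular action. Then the following hold. 1. (Objects.) Sending $(V,\lambda)$ to $(V,\beta_V)$ with $\beta_V(v)=\lambda_{H_L}(v\otimes1)$ is a bijection from the objects of $({}_H\mathcal M)^\circ$ onto the pairs $(V,\beta_V)$ where $V$ is an $H$-module and $\beta_V:V\to H\otimes V$, written $\beta_V(v)=\sum v^{\bar{(1)}}\otimes v^{\bar{(2)}}$, is a $k$-linear map such that for all $h\in H$, $v\in V$ $$\sum h_{(1)}v^{\bar{(1)}}\otimes h_{(2)}\triangleright v^{\bar{(2)}}=\sum(h_{(1)}\triangleright v)^{\bar{(1)}}h_{(2)}\otimes(h_{(1)}\triangleright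 v)^{\bar{(2)}},$$ $$\sum\phi^{(1)}v^{\bar{(1)}}\otimes(\phi^{(2)}\triangleright v^{\bar{(2)}})^{\bar{(1)}}\phi^{(3)}\otimes(\phi^{(2)}\triangleright v^{\bar{(2)}})^{\bar{(2)}}=\phi\triangleright\Big(\sum(\phi^{(1)}\triangleright v)^{\bar{(1)}}{}_{(1)}\phi^{(2)}\otimes(\phi^{(1)}\triangleright v)^{\bar{(1)}}{}_{(2)}\phi^{(3)}\otimes(\phi^{(1)}\triangleright v)^{\bar{(2)}}\Big),$$ with $\phi$ acting on $H_L\otimes H_L\otimes V$ on the right, and $(\epsilon\otimes\mathrm{id})\circ\beta_V=\mathrm{id}$. Moreover $\lambda_W(v\otimes w)=\sum v^{\bar{(1)}}\triangleright w\otimes v^{\bar{(2)}}$ for every $H$-module $W$. 2. (Morphisms.) The morphisms from $(V,\lambda^V)$ to $(W,\lambda^W)$ in $({}_H\mathcal M)^\circ$ are exactly the $H$-module maps $f:V\to W$ with $(\mathrm{id}\otimes f)\circ\beta_V=\beta_W\circ f$. 3. (Tensor product.) The tensor product of the objects corresponding to $(V,\beta_V)$ and $(W,\beta_W)$ is built on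 the $H$-module $V\otimes W$ and corresponds to $$\beta_{V\otimes W}(v\otimes w)=\phi\triangleright\Big(\sum(\phi^{-(1)}\phi^{(1)}\triangleright v)^{\bar{(1)}}\phi^{-(2)}(\phi^{(2)}\triangleright w)^{\bar{(1)}}\phi^{(3)}\otimes(\phi^{-(1)}\phi^{(1)}\triangleright v)^{\bar{(2)}}\otimes\phi^{-(3)}\triangleright(\phi^{(2)}\triangleright w)^{\bar{(2)}}\Big),$$ where the outer $\phi$ acts on $H_L\otimes V\otimes W$. 4. (Associator.) The associator of $({}_H\mathcal M)^\circ$ is $(v\otimes w)\otimes z\mapsto\sum\phi^{(1)}\triangleright v\otimes(\phi^{(2)}\triangleright w\otimes\phi^{(3)}\triangleright z)$. 5. (Braiding.) $({}_H\mathcal M)^\circ$ is braided, with $\Psi_{V,W}(v\otimes w)=\sum v^{\bar{(1)}}\triangleright w\otimes v^{\bar{(2)}}$. -/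

import Mathlib

open CategoryTheory MonoidalCategory
open scoped TensorProduct

universe u

namespace QuasiHopf

/-- A quasi-bialgebra `(H, Δ, ε, φ)` over a commutative ring `k`.
The threefold tensor power of `H` is bracketed to the right, `H ⊗ (H ⊗ H)`. -/
class QuasiBialgebra (k H : Type u) [CommRing k] [Ring H] [Algebra k H] where
  /-- the coproduct `Δ` -/
  comul : H →ₐ[k] H ⊗[k] H
  /-- the counit `ε` -/
  counit : H →ₐ[k] k
  /-- the invertible element `φ` -/
  phi : (H ⊗[k] (H ⊗[k] H))ˣ
  /-- `(id ⊗ Δ)(Δ h) = φ ((Δ ⊗ id)(Δ h)) φ⁻¹` -/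
  quasi_coassoc : ∀ h : H,
    Algebra.TensorProduct.map (AlgHom.id k H) comul (comul h) =
      (phi : H ⊗[k] (H ⊗[k] H)) *
        Algebra.TensorProduct.assoc k k k H H H
          (Algebra.TensorProduct.map comul (AlgHom.id k H) (comul h)) *
        ((phi⁻¹ : (H ⊗[k] (H ⊗[k] H))ˣ) : H ⊗[k] (H ⊗[k] H))
  /-- `(ε ⊗ id)(Δ h) = h` -/
  counit_comul : ∀ h : H,
    Algebra.TensorProduct.lid k H
      (Algebra.TensorProduct.map counit (AlgHom.id k H) (comul h)) = h
  /-- `(id ⊗ ε)(Δ h) = h` -/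
  comul_counit : ∀ h : H,
    Algebra.TensorProduct.rid k k H
      (Algebra.TensorProduct.map (AlgHom.id k H) counit (comul h)) = h
  /-- The 3-cocycle condition
  `(1 ⊗ φ) ((id ⊗ Δ ⊗ id) φ) (φ ⊗ 1) = ((id ⊗ id ⊗ Δ) φ) ((Δ ⊗ id ⊗ id) φ)`. -/
  cocycle :
    ((1 : H) ⊗ₜ[k] (phi : H ⊗[k] (H ⊗[k] H))) *
      Algebra.TensorProduct.map (AlgHom.id k H)
        ((Algebra.TensorProduct.assoc k k k H H H).toAlgHom.comp
          (Algebra.TensorProduct.map comul (AlgHom.id k H))) phi *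
      Algebra.TensorProduct.map (AlgHom.id k H)
        (Algebra.TensorProduct.map (AlgHom.id k H)
          (Algebra.TensorProduct.includeLeft : H →ₐ[k] H ⊗[k] H)) phi =
    Algebra.TensorProduct.map (AlgHom.id k H)
        (Algebra.TensorProduct.map (AlgHom.id k H) comul) phi *
      Algebra.TensorProduct.assoc k k k H H (H ⊗[k] H)
        (Algebra.TensorProduct.map comul (AlgHom.id k (H ⊗[k] H)) phi)
  /-- `(id ⊗ ε ⊗ id) φ = 1 ⊗ 1` -/
  counit_phi :
    Algebra.TensorProduct.map (AlgHom.id k H)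
      ((Algebra.TensorProduct.lid k H).toAlgHom.comp
        (Algebra.TensorProduct.map counit (AlgHom.id k H)))
      (phi : H ⊗[k] (H ⊗[k] H)) = 1

/-- A quasi-Hopf algebra: a quasi-bialgebra with an antipode `(S, α, β)`, where `S` is a unital
algebra anti-homomorphism. Bijectivity of `S` is not part of the structure. -/
class QuasiHopfAlgebra (k H : Type u) [CommRing k] [Ring H] [Algebra k H] extends
    QuasiBialgebra k H where
  /-- the antipode `S` -/
  antipode : H →ₗ[k] H
  antipode_one : antipode 1 = 1
  antipode_mul : ∀ a b : H, antipode (a * b) = antipode b * antipode a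
  /-- the element `α` -/
  alpha : H
  /-- the element `β` -/
  beta : H
  /-- `∑ S(h₁) α h₂ = ε(h) α` -/
  antipode_alpha : ∀ h : H,
    LinearMap.mul' k H
      (TensorProduct.map (LinearMap.mulRight k alpha ∘ₗ antipode) LinearMap.id (comul h)) =
      counit h • alpha
  /-- `∑ h₁ β S(h₂) = ε(h) β` -/
  antipode_beta : ∀ h : H,
    LinearMap.mul' k H
      (TensorProduct.map LinearMap.id (LinearMap.mulLeft k beta ∘ₗ antipode) (comul h)) =
      counit h • beta
  /-- `∑ φ¹ β S(φ²) α φ³ = 1` -/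
  antipode_phi :
    LinearMap.mul' k H
      (TensorProduct.map LinearMap.id
        (LinearMap.mul' k H ∘ₗ TensorProduct.map
          (LinearMap.mulRight k alpha ∘ₗ LinearMap.mulLeft k beta ∘ₗ antipode) LinearMap.id)
        (phi : H ⊗[k] (H ⊗[k] H))) = 1
  /-- `∑ S(φ⁻¹) α φ⁻² β S(φ⁻³) = 1` -/
  antipode_phi_inv :
    LinearMap.mul' k H
      (TensorProduct.map antipode
        (LinearMap.mul' k H ∘ₗ TensorProduct.map
          (LinearMap.mulRight k beta ∘ₗ LinearMap.mulLeft k alpha) antipode)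
        ((phi⁻¹ : (H ⊗[k] (H ⊗[k] H))ˣ) : H ⊗[k] (H ⊗[k] H))) = 1

open QuasiBialgebra

/-- `φ` as an element of `H ⊗ (H ⊗ H)`. -/
abbrev phiVal (k H : Type u) [CommRing k] [Ring H] [Algebra k H] [QuasiBialgebra k H] :
    H ⊗[k] (H ⊗[k] H) :=
  (phi : (H ⊗[k] (H ⊗[k] H))ˣ)

/-- `φ⁻¹` as an element of `H ⊗ (H ⊗ H)`. -/
abbrev phiInv (k H : Type u) [CommRing k] [Ring H] [Algebra k H] [QuasiBialgebra k H] :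
    H ⊗[k] (H ⊗[k] H) :=
  (phi⁻¹ : (H ⊗[k] (H ⊗[k] H))ˣ)

/-- A left module over the `k`-algebra `H`: a `k`-module with a homomorphism of `k`-algebras from
`H` to its endomorphisms. -/
structure HMod (k H : Type u) [CommRing k] [Ring H] [Algebra k H] where
  carrier : Type u
  [addCommGroup : AddCommGroup carrier]
  [module : Module k carrier]
  act : H →ₐ[k] Module.End k carrier

namespace HMod

variable {k H : Type u} [CommRing k] [Ring H] [Algebra k H]

instance : CoeSort (HMod k H) (Type u) := ⟨HMod.carrier⟩

instance (V : HMod k H) : AddCommGroup V := V.addCommGroup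
instance (V : HMod k H) : Module k V := V.module

/-- A morphism of `H`-modules. -/
@[ext]
structure Hom (V W : HMod k H) where
  lin : V →ₗ[k] W
  comm : ∀ (h : H) (v : V), lin (V.act h v) = W.act h (lin v)

instance : Category (HMod k H) where
  Hom V W := Hom V W
  id V := ⟨LinearMap.id, fun _ _ => rfl⟩
  comp f g := ⟨g.lin ∘ₗ f.lin, fun h v => by simp [f.comm, g.comm]⟩

/-- The underlying linear map of a morphism of `H`-modules. -/
def lin {V W : HMod k H} (f : V ⟶ W) : V →ₗ[k] W := Hom.lin f

theorem hom_ext {V W : HMod k H} {f g : V ⟶ W} (h : lin f = lin g) : f = g := Hom.ext h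

@[simp] theorem lin_id (V : HMod k H) : lin (𝟙 V) = LinearMap.id := rfl

@[simp] theorem lin_comp {V W Z : HMod k H} (f : V ⟶ W) (g : W ⟶ Z) :
    lin (f ≫ g) = lin g ∘ₗ lin f := rfl

theorem lin_act {V W : HMod k H} (f : V ⟶ W) (h : H) (v : V) :
    lin f (V.act h v) = W.act h (lin f v) := Hom.comm f h v

/-- An isomorphism of `H`-modules from an `H`-equivariant linear equivalence. -/
def mkIso {V W : HMod k H} (e : V ≃ₗ[k] W) (he : ∀ (h : H) (v : V), e (V.act h v) = W.act h (e v)) :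
    V ≅ W where
  hom := (⟨e.toLinearMap, he⟩ : Hom V W)
  inv := (⟨e.symm.toLinearMap, fun h w => by
    apply e.injective
    simp [he]⟩ : Hom W V)
  hom_inv_id := hom_ext (by ext v; exact e.symm_apply_apply v)
  inv_hom_id := hom_ext (by ext v; exact e.apply_symm_apply v)

@[simp] theorem lin_mkIso_hom {V W : HMod k H} (e : V ≃ₗ[k] W) (he) :
    lin (mkIso e he).hom = e.toLinearMap := rfl

@[simp] theorem lin_mkIso_inv {V W : HMod k H} (e : V ≃ₗ[k] W) (he) :
    lin (mkIso e he).inv = e.symm.toLinearMap := rfl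

end HMod

section Action

variable {k : Type u} [CommRing k]

/-- The action of `A ⊗ B` on `V ⊗ W` for an action of `A` on `V` and one of `B` on `W`:
`(a ⊗ b) ▷ (v ⊗ w) = a ▷ v ⊗ b ▷ w`. -/
def tensorAct {A B V W : Type u} [Ring A] [Algebra k A] [Ring B] [Algebra k B]
    [AddCommGroup V] [Module k V] [AddCommGroup W] [Module k W]
    (f : A →ₐ[k] Module.End k V) (g : B →ₐ[k] Module.End k W) :
    A ⊗[k] B →ₐ[k] Module.End k (V ⊗[k] W) :=
  (Module.endTensorEndAlgHom (R := k) (S := k) (A := k) (M := V) (N := W)).comp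
    (Algebra.TensorProduct.map f g)

@[simp] theorem tensorAct_tmul {A B V W : Type u} [Ring A] [Algebra k A] [Ring B] [Algebra k B]
    [AddCommGroup V] [Module k V] [AddCommGroup W] [Module k W]
    (f : A →ₐ[k] Module.End k V) (g : B →ₐ[k] Module.End k W) (a : A) (b : B) (v : V) (w : W) :
    tensorAct f g (a ⊗ₜ[k] b) (v ⊗ₜ[k] w) = f a v ⊗ₜ[k] g b w := rfl

theorem tensorAct_comp_map {A B A' B' V W : Type u} [Ring A] [Algebra k A] [Ring B] [Algebra k B]
    [Ring A'] [Algebra k A'] [Ring B'] [Algebra k B']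
    [AddCommGroup V] [Module k V] [AddCommGroup W] [Module k W]
    (f : A →ₐ[k] Module.End k V) (g : B →ₐ[k] Module.End k W) (p : A' →ₐ[k] A) (q : B' →ₐ[k] B)
    (x : A' ⊗[k] B') :
    tensorAct (f.comp p) (g.comp q) x = tensorAct f g (Algebra.TensorProduct.map p q x) := by
  induction x with
  | zero => simp
  | tmul a b => rfl
  | add x y hx hy => simp only [map_add, hx, hy]

/-- Equivariant maps `p`, `q` give an equivariant map `p ⊗ q`. -/
theorem map_tensorAct {A B V W V' W' : Type u} [Ring A] [Algebra k A] [Ring B] [Algebra k B]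
    [AddCommGroup V] [Module k V] [AddCommGroup W] [Module k W]
    [AddCommGroup V'] [Module k V'] [AddCommGroup W'] [Module k W']
    (f : A →ₐ[k] Module.End k V) (g : B →ₐ[k] Module.End k W)
    (f' : A →ₐ[k] Module.End k V') (g' : B →ₐ[k] Module.End k W')
    (p : V →ₗ[k] V') (q : W →ₗ[k] W')
    (hp : ∀ a v, p (f a v) = f' a (p v)) (hq : ∀ b w, q (g b w) = g' b (q w))
    (x : A ⊗[k] B) (t : V ⊗[k] W) :
    TensorProduct.map p q (tensorAct f g x t) = tensorAct f' g' x (TensorProduct.map p q t) := by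
  induction x with
  | zero => simp
  | add x y hx hy => simp only [map_add, LinearMap.add_apply, hx, hy]
  | tmul a b =>
    induction t with
    | zero => simp
    | add s t hs ht => simp only [map_add, hs, ht]
    | tmul v w => simp [hp, hq]

theorem assoc_tensorAct {A B C V W Z : Type u} [Ring A] [Algebra k A] [Ring B] [Algebra k B]
    [Ring C] [Algebra k C] [AddCommGroup V] [Module k V] [AddCommGroup W] [Module k W]
    [AddCommGroup Z] [Module k Z]
    (f : A →ₐ[k] Module.End k V) (g : B →ₐ[k] Module.End k W) (l : C →ₐ[k] Module.End k Z)
    (x : (A ⊗[k] B) ⊗[k] C) (t : (V ⊗[k] W) ⊗[k] Z) :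
    TensorProduct.assoc k V W Z (tensorAct (tensorAct f g) l x t) =
      tensorAct f (tensorAct g l) (Algebra.TensorProduct.assoc k k k A B C x)
        (TensorProduct.assoc k V W Z t) := by
  induction x with
  | zero => simp
  | add x y hx hy => simp only [map_add, LinearMap.add_apply, hx, hy]
  | tmul a c =>
    induction a with
    | zero => simp
    | add x y hx hy => simp only [TensorProduct.add_tmul, map_add, LinearMap.add_apply, hx, hy]
    | tmul a b =>
      induction t with
      | zero => simp
      | add s t hs ht => simp only [map_add, hs, ht]
      | tmul v z =>
        induction v with
        | zero => simp
        | add s t hs ht => simp only [TensorProduct.add_tmul, map_add, hs, ht]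
        | tmul v w => simp

end Action

namespace HMod

variable {k H : Type u} [CommRing k] [Ring H] [Algebra k H]

/-- The left regular module `H_L`. -/
def regular (k H : Type u) [CommRing k] [Ring H] [Algebra k H] : HMod k H where
  carrier := H
  act := Algebra.lmul k H

/-- The orbit map `h ↦ h ▷ v`. -/
def orbit (V : HMod k H) (v : V) : H →ₗ[k] V := V.act.toLinearMap.flip v

@[simp] theorem orbit_apply (V : HMod k H) (v : V) (h : H) : V.orbit v h = V.act h v := rfl

/-- The action of `H ⊗ (H ⊗ H)` on `V ⊗ (W ⊗ Z)`:
`(a ⊗ (b ⊗ c)) ▷ (v ⊗ (w ⊗ z)) = a ▷ v ⊗ (b ▷ w ⊗ c ▷ z)`. -/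
def act₃ (V W Z : HMod k H) :
    H ⊗[k] (H ⊗[k] H) →ₐ[k] Module.End k (V ⊗[k] (W ⊗[k] Z)) :=
  tensorAct V.act (tensorAct W.act Z.act)

@[simp] theorem act₃_tmul (V W Z : HMod k H) (a b c : H) (v : V) (w : W) (z : Z) :
    act₃ V W Z (a ⊗ₜ[k] (b ⊗ₜ[k] c)) (v ⊗ₜ[k] (w ⊗ₜ[k] z)) =
      V.act a v ⊗ₜ[k] (W.act b w ⊗ₜ[k] Z.act c z) := rfl

/-- For a linear map `β : V → H ⊗ V`, written `β v = ∑ v⁽¹⁾ ⊗ v⁽²⁾`, and an `H`-module `W`, the map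
`V ⊗ W → W ⊗ V`, `v ⊗ w ↦ ∑ v⁽¹⁾ ▷ w ⊗ v⁽²⁾`. -/
def twist {V : HMod k H} (β : V →ₗ[k] H ⊗[k] V) (W : HMod k H) : V ⊗[k] W →ₗ[k] W ⊗[k] V :=
  TensorProduct.lift
    (LinearMap.lcomp k (W ⊗[k] V) β ∘ₗ LinearMap.rTensorHom V ∘ₗ W.act.toLinearMap.flip).flip

theorem twist_tmul {V : HMod k H} (β : V →ₗ[k] H ⊗[k] V) (W : HMod k H) (v : V) (w : W) :
    twist β W (v ⊗ₜ[k] w) = LinearMap.rTensor V (W.orbit w) (β v) := rfl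

/-- The map `V ⊗ H → H ⊗ V`, `v ⊗ g ↦ ∑ v⁽¹⁾ g ⊗ v⁽²⁾`. -/
def twistH {V : HMod k H} (β : V →ₗ[k] H ⊗[k] V) : V ⊗[k] H →ₗ[k] H ⊗[k] V :=
  twist β (regular k H)

theorem phi_one (x : H ⊗[k] (H ⊗[k] H)) :
    Algebra.TensorProduct.map (AlgHom.id k H)
        (Algebra.TensorProduct.assoc k k k H H H).toAlgHom
      (Algebra.TensorProduct.assoc k k k H (H ⊗[k] H) H (x ⊗ₜ[k] 1)) =
    Algebra.TensorProduct.map (AlgHom.id k H)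
        (Algebra.TensorProduct.map (AlgHom.id k H)
          (Algebra.TensorProduct.includeLeft : H →ₐ[k] H ⊗[k] H)) x := by
  induction x with
  | zero => simp
  | add s t hs ht => simp only [TensorProduct.add_tmul, map_add, hs, ht]
  | tmul a x =>
    induction x with
    | zero => simp
    | add s t hs ht => simp only [TensorProduct.add_tmul, TensorProduct.tmul_add, map_add, hs, ht]
    | tmul b c => rfl

variable [QuasiBialgebra k H]

/-- The tensor product of `H`-modules: `V ⊗ W` with `h ▷ (v ⊗ w) = ∑ h₁ ▷ v ⊗ h₂ ▷ w`. -/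
def tensor (V W : HMod k H) : HMod k H where
  carrier := V ⊗[k] W
  act := (tensorAct V.act W.act).comp comul

/-- The unit object: `k` with `H` acting through `ε`. -/
def unit (k H : Type u) [CommRing k] [Ring H] [Algebra k H] [QuasiBialgebra k H] : HMod k H where
  carrier := k
  act := (Algebra.lmul k k).comp counit

/-- Invertible elements of `H ⊗ (H ⊗ H)` act by linear automorphisms of `V ⊗ (W ⊗ Z)`. -/
def actEquiv (V W Z : HMod k H) (x : (H ⊗[k] (H ⊗[k] H))ˣ) :
    (V ⊗[k] (W ⊗[k] Z)) ≃ₗ[k] V ⊗[k] (W ⊗[k] Z) where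
  toLinearMap := act₃ V W Z x
  invFun := act₃ V W Z (x⁻¹ : (H ⊗[k] (H ⊗[k] H))ˣ)
  left_inv t := by
    change (act₃ V W Z _ * act₃ V W Z _) t = t
    rw [← map_mul]; simp
  right_inv t := by
    change (act₃ V W Z _ * act₃ V W Z _) t = t
    rw [← map_mul]; simp

theorem tensor_act_tensor_left (V W Z : HMod k H) (x : H ⊗[k] H) :
    tensorAct (tensor V W).act Z.act x =
      tensorAct (tensorAct V.act W.act) Z.act
        (Algebra.TensorProduct.map comul (AlgHom.id k H) x) :=
  tensorAct_comp_map (tensorAct V.act W.act) Z.act comul (AlgHom.id k H) x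

theorem tensor_act_tensor_right (V W Z : HMod k H) (x : H ⊗[k] H) :
    tensorAct V.act (tensor W Z).act x =
      act₃ V W Z (Algebra.TensorProduct.map (AlgHom.id k H) comul x) :=
  tensorAct_comp_map V.act (tensorAct W.act Z.act) (AlgHom.id k H) comul x

theorem assoc_equivariant (V W Z : HMod k H) (h : H) (t : (V ⊗[k] W) ⊗[k] Z) :
    act₃ V W Z (phiVal k H) (TensorProduct.assoc k V W Z (tensorAct (tensor V W).act Z.act (comul h) t)) =
      tensorAct V.act (tensor W Z).act (comul h)
        (act₃ V W Z (phiVal k H) (TensorProduct.assoc k V W Z t)) := by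
  have e1 := tensor_act_tensor_left V W Z (comul h)
  have e2 := tensor_act_tensor_right V W Z (comul h)
  have e3 := assoc_tensorAct V.act W.act Z.act
    (Algebra.TensorProduct.map comul (AlgHom.id k H) (comul h)) t
  have e4 : ∀ (x y : H ⊗[k] (H ⊗[k] H)) (s : V ⊗[k] (W ⊗[k] Z)),
      act₃ V W Z x (act₃ V W Z y s) = act₃ V W Z (x * y) s := fun x y s => by
    rw [map_mul]; rfl
  have e5 : TensorProduct.assoc k V W Z (tensorAct (tensor V W).act Z.act (comul h) t) =
      act₃ V W Z (Algebra.TensorProduct.assoc k k k H H H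
          (Algebra.TensorProduct.map comul (AlgHom.id k H) (comul h)))
        (TensorProduct.assoc k V W Z t) :=
    (congrArg (fun u => TensorProduct.assoc k V W Z (u t)) e1).trans e3
  refine (congrArg _ e5).trans ?_
  refine Eq.trans ?_ (congrArg (fun u => u (act₃ V W Z (phiVal k H)
    (TensorProduct.assoc k V W Z t))) e2).symm
  refine (e4 _ _ _).trans (Eq.trans ?_ (e4 _ _ _).symm)
  rw [quasi_coassoc, mul_assoc _ _ (phiVal k H), Units.inv_mul, mul_one]

/-- The associativity isomorphism
`Φ ((v ⊗ w) ⊗ z) = ∑ φ¹ ▷ v ⊗ (φ² ▷ w ⊗ φ³ ▷ z)`. -/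
def assoc (V W Z : HMod k H) : tensor (tensor V W) Z ≅ tensor V (tensor W Z) :=
  mkIso (V := tensor (tensor V W) Z) (W := tensor V (tensor W Z))
    ((TensorProduct.assoc k V W Z).trans (actEquiv V W Z phi)) (assoc_equivariant V W Z)

theorem lid_tensorAct {B W : Type u} [Ring B] [Algebra k B] [AddCommGroup W] [Module k W]
    (g : B →ₐ[k] Module.End k W) (x : H ⊗[k] B) (t : k ⊗[k] W) :
    TensorProduct.lid k W (tensorAct ((Algebra.lmul k k).comp (counit (k := k) (H := H))) g x t) =
      g (Algebra.TensorProduct.lid k B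
        (Algebra.TensorProduct.map counit (AlgHom.id k B) x)) (TensorProduct.lid k W t) := by
  induction x with
  | zero => simp
  | add x y hx hy => simp only [map_add, LinearMap.add_apply, hx, hy]
  | tmul a b =>
    induction t with
    | zero => simp
    | add s t hs ht => simp only [map_add, hs, ht]
    | tmul c w =>
      change (counit (k := k) a * c) • g b w = g (counit (k := k) a • b) (c • w)
      simp [mul_smul, smul_comm c]

theorem rid_tensorAct {A V : Type u} [Ring A] [Algebra k A] [AddCommGroup V] [Module k V]
    (f : A →ₐ[k] Module.End k V) (x : A ⊗[k] H) (t : V ⊗[k] k) :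
    TensorProduct.rid k V (tensorAct f ((Algebra.lmul k k).comp (counit (k := k) (H := H))) x t) =
      f (Algebra.TensorProduct.rid k k A
        (Algebra.TensorProduct.map (AlgHom.id k A) counit x)) (TensorProduct.rid k V t) := by
  induction x with
  | zero => simp
  | add x y hx hy => simp only [map_add, LinearMap.add_apply, hx, hy]
  | tmul a b =>
    induction t with
    | zero => simp
    | add s t hs ht => simp only [map_add, hs, ht]
    | tmul v c =>
      change (counit (k := k) b * c) • f a v = f (counit (k := k) b • a) (c • v)
      simp [mul_smul, smul_comm c]

/-- The left unit isomorphism `c ⊗ v ↦ c v`. -/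
def leftUnit (V : HMod k H) : tensor (unit k H) V ≅ V :=
  mkIso (V := tensor (unit k H) V) (W := V) (TensorProduct.lid k V) (by
    intro h t
    exact (lid_tensorAct V.act (comul h) t).trans (by rw [counit_comul]; rfl))

/-- The right unit isomorphism `v ⊗ c ↦ c v`. -/
def rightUnit (V : HMod k H) : tensor V (unit k H) ≅ V :=
  mkIso (V := tensor V (unit k H)) (W := V) (TensorProduct.rid k V) (by
    intro h t
    exact (rid_tensorAct V.act (comul h) t).trans (by rw [comul_counit]; rfl))

/-- The tensor product of morphisms. -/
def tensorMap {V V' W W' : HMod k H} (f : V ⟶ V') (g : W ⟶ W') : tensor V W ⟶ tensor V' W' :=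
  (⟨TensorProduct.map (lin f) (lin g), fun h t =>
    map_tensorAct V.act W.act V'.act W'.act _ _ (lin_act f) (lin_act g) (comul h) t⟩ :
    Hom (tensor V W) (tensor V' W'))

theorem assoc_natural {V V' W W' Z Z' : HMod k H} (f : V ⟶ V') (g : W ⟶ W') (l : Z ⟶ Z')
    (t : (V ⊗[k] W) ⊗[k] Z) :
    act₃ V' W' Z' (phiVal k H) (TensorProduct.assoc k V' W' Z'
      (TensorProduct.map (TensorProduct.map (lin f) (lin g)) (lin l) t)) =
    TensorProduct.map (lin f) (TensorProduct.map (lin g) (lin l))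
      (act₃ V W Z (phiVal k H) (TensorProduct.assoc k V W Z t)) := by
  have e := map_tensorAct V.act (tensorAct W.act Z.act) V'.act (tensorAct W'.act Z'.act)
    (lin f) (TensorProduct.map (lin g) (lin l)) (lin_act f)
    (map_tensorAct W.act Z.act W'.act Z'.act _ _ (lin_act g) (lin_act l))
    (phiVal k H) (TensorProduct.assoc k V W Z t)
  refine Eq.trans ?_ e.symm
  change act₃ V' W' Z' (phiVal k H) _ = act₃ V' W' Z' (phiVal k H) _
  congr 1
  exact congrArg (fun u => u t) (TensorProduct.map_map_comp_assoc_eq (lin f) (lin g) (lin l)).symm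

theorem triangle_aux (V W : HMod k H) (t : (V ⊗[k] k) ⊗[k] W) :
    TensorProduct.map LinearMap.id (TensorProduct.lid k W).toLinearMap
      (act₃ V (unit k H) W (phiVal k H) (TensorProduct.assoc k V k W t)) =
    TensorProduct.map (TensorProduct.rid k V).toLinearMap LinearMap.id t := by
  have e := map_tensorAct V.act (tensorAct ((Algebra.lmul k k).comp (counit (k := k) (H := H))) W.act) (V.act.comp (AlgHom.id k H))
    (W.act.comp ((Algebra.TensorProduct.lid k H).toAlgHom.comp
        (Algebra.TensorProduct.map counit (AlgHom.id k H))))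
    LinearMap.id (TensorProduct.lid k W).toLinearMap (fun _ _ => rfl)
    (fun x s => lid_tensorAct W.act x s) (phiVal k H) (TensorProduct.assoc k V k W t)
  refine e.trans ?_
  rw [tensorAct_comp_map, counit_phi, map_one]
  clear e
  change TensorProduct.map LinearMap.id (TensorProduct.lid k W).toLinearMap _ = _
  induction t with
  | zero => simp
  | add s t hs ht => simp only [map_add, hs, ht]
  | tmul v z =>
    induction v with
    | zero => simp
    | add s t hs ht => simp only [TensorProduct.add_tmul, map_add, hs, ht]
    | tmul v w => simp [TensorProduct.smul_tmul]

theorem pentagon_aux (V W X Y : HMod k H) (t : ((V ⊗[k] W) ⊗[k] X) ⊗[k] Y) :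
    TensorProduct.map LinearMap.id ((act₃ W X Y (phiVal k H)) ∘ₗ (TensorProduct.assoc k W X Y).toLinearMap)
      (act₃ V (tensor W X) Y (phiVal k H) (TensorProduct.assoc k V (W ⊗[k] X) Y
        (TensorProduct.map ((act₃ V W X (phiVal k H)) ∘ₗ (TensorProduct.assoc k V W X).toLinearMap)
          LinearMap.id t))) =
    act₃ V W (tensor X Y) (phiVal k H) (TensorProduct.assoc k V W (X ⊗[k] Y)
      (act₃ (tensor V W) X Y (phiVal k H) (TensorProduct.assoc k (V ⊗[k] W) X Y t))) := by
  -- the action of fourfold tensors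
  let A := tensorAct V.act (act₃ W X Y)
  have hA : ∀ x y s, A x (A y s) = A (x * y) s := fun x y s => by rw [map_mul]; rfl
  have a1 : ∀ s : V ⊗[k] ((W ⊗[k] X) ⊗[k] Y),
      TensorProduct.map LinearMap.id
        ((act₃ W X Y (phiVal k H)) ∘ₗ (TensorProduct.assoc k W X Y).toLinearMap) s =
      A (1 ⊗ₜ[k] (phiVal k H)) (TensorProduct.map LinearMap.id
        (TensorProduct.assoc k W X Y).toLinearMap s) := fun s => by
    induction s with
    | zero => simp
    | add s t hs ht => simp only [map_add, hs, ht]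
    | tmul v z => simp [A]
  have a2 : ∀ s : V ⊗[k] ((W ⊗[k] X) ⊗[k] Y),
      TensorProduct.map LinearMap.id (TensorProduct.assoc k W X Y).toLinearMap
        (act₃ V (tensor W X) Y (phiVal k H) s) =
      A (Algebra.TensorProduct.map (AlgHom.id k H)
        ((Algebra.TensorProduct.assoc k k k H H H).toAlgHom.comp
          (Algebra.TensorProduct.map comul (AlgHom.id k H))) (phiVal k H))
        (TensorProduct.map LinearMap.id (TensorProduct.assoc k W X Y).toLinearMap s) := fun s => by
    rw [← tensorAct_comp_map]
    refine map_tensorAct V.act (tensorAct (tensor W X).act Y.act) (V.act.comp (AlgHom.id k H))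
      ((act₃ W X Y).comp _) LinearMap.id
      (TensorProduct.assoc k W X Y).toLinearMap (fun _ _ => rfl) (fun x r => ?_) (phiVal k H) s
    rw [tensor_act_tensor_left]
    exact assoc_tensorAct W.act X.act Y.act _ r
  have a3 : ∀ s : (V ⊗[k] (W ⊗[k] X)) ⊗[k] Y,
      TensorProduct.map LinearMap.id (TensorProduct.assoc k W X Y).toLinearMap
        (TensorProduct.assoc k V (W ⊗[k] X) Y
          (TensorProduct.map (act₃ V W X (phiVal k H)) LinearMap.id s)) =
      A (Algebra.TensorProduct.map (AlgHom.id k H)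
        (Algebra.TensorProduct.map (AlgHom.id k H)
          (Algebra.TensorProduct.includeLeft : H →ₐ[k] H ⊗[k] H)) (phiVal k H))
        (TensorProduct.map LinearMap.id (TensorProduct.assoc k W X Y).toLinearMap
          (TensorProduct.assoc k V (W ⊗[k] X) Y s)) := fun s => by
    have e1 : TensorProduct.map (act₃ V W X (phiVal k H)) LinearMap.id s =
        tensorAct (act₃ V W X) Y.act ((phiVal k H) ⊗ₜ[k] 1) s := by
      induction s with
      | zero => simp
      | add s t hs ht => simp only [map_add, hs, ht]
      | tmul v z => simp
    have e2 := assoc_tensorAct V.act (tensorAct W.act X.act) Y.act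
      ((phiVal k H) ⊗ₜ[k] 1) s
    have e3 := map_tensorAct V.act (tensorAct (tensorAct W.act X.act) Y.act)
      (V.act.comp (AlgHom.id k H))
      ((act₃ W X Y).comp (Algebra.TensorProduct.assoc k k k H H H).toAlgHom)
      LinearMap.id (TensorProduct.assoc k W X Y).toLinearMap (fun _ _ => rfl)
      (fun x r => assoc_tensorAct W.act X.act Y.act x r)
      (Algebra.TensorProduct.assoc k k k H (H ⊗[k] H) H
        ((phiVal k H) ⊗ₜ[k] 1))
      (TensorProduct.assoc k V (W ⊗[k] X) Y s)
    rw [tensorAct_comp_map, phi_one] at e3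
    rw [e1]
    exact (congrArg _ e2).trans e3
  have a4 : ∀ s : (V ⊗[k] W) ⊗[k] (X ⊗[k] Y),
      TensorProduct.assoc k V W (X ⊗[k] Y) (act₃ (tensor V W) X Y (phiVal k H) s) =
      A (Algebra.TensorProduct.assoc k k k H H (H ⊗[k] H)
        (Algebra.TensorProduct.map comul (AlgHom.id k (H ⊗[k] H)) (phiVal k H)))
        (TensorProduct.assoc k V W (X ⊗[k] Y) s) := fun s => by
    have e := tensorAct_comp_map (tensorAct V.act W.act) (tensorAct X.act Y.act) comul
      (AlgHom.id k (H ⊗[k] H)) (phiVal k H)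
    exact (congrArg (fun u => TensorProduct.assoc k V W (X ⊗[k] Y) (u s)) e).trans
      (assoc_tensorAct V.act W.act (tensorAct X.act Y.act) _ s)
  have a5 : ∀ s : V ⊗[k] (W ⊗[k] (X ⊗[k] Y)),
      act₃ V W (tensor X Y) (phiVal k H) s =
      A (Algebra.TensorProduct.map (AlgHom.id k H)
        (Algebra.TensorProduct.map (AlgHom.id k H) comul) (phiVal k H)) s := fun s => by
    have e : tensorAct W.act (tensor X Y).act =
        (act₃ W X Y).comp (Algebra.TensorProduct.map (AlgHom.id k H) comul) :=
      AlgHom.ext (tensor_act_tensor_right W X Y)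
    have e' := tensorAct_comp_map V.act (act₃ W X Y) (AlgHom.id k H)
      (Algebra.TensorProduct.map (AlgHom.id k H) comul) (phiVal k H)
    refine (congrArg (fun u => tensorAct V.act u (phiVal k H) s) e).trans ?_
    exact congrArg (fun u => u s) e'
  have a7 : TensorProduct.map LinearMap.id (TensorProduct.assoc k W X Y).toLinearMap
      (TensorProduct.assoc k V (W ⊗[k] X) Y
        (TensorProduct.map (TensorProduct.assoc k V W X).toLinearMap
          (LinearMap.id : Y →ₗ[k] Y) t)) =
      TensorProduct.assoc k V W (X ⊗[k] Y) (TensorProduct.assoc k (V ⊗[k] W) X Y t) := by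
    induction t with
    | zero => simp
    | add s t hs ht => simp only [map_add, hs, ht]
    | tmul t y =>
      induction t with
      | zero => simp
      | add s t hs ht => simp only [TensorProduct.add_tmul, map_add, hs, ht]
      | tmul t x =>
        induction t with
        | zero => simp
        | add s t hs ht => simp only [TensorProduct.add_tmul, map_add, hs, ht]
        | tmul v w => simp
  have a6 : TensorProduct.map ((act₃ V W X (phiVal k H)) ∘ₗ (TensorProduct.assoc k V W X).toLinearMap)
      LinearMap.id t = TensorProduct.map (act₃ V W X (phiVal k H)) LinearMap.id
        (TensorProduct.map (TensorProduct.assoc k V W X).toLinearMap (LinearMap.id : Y →ₗ[k] Y) t) := by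
    rw [← LinearMap.comp_apply, ← TensorProduct.map_comp]; rfl
  refine (a1 _).trans ?_
  refine (congrArg _ (a2 _)).trans ?_
  rw [a6]
  refine (congrArg (fun u => A _ (A _ u)) (a3 _)).trans ?_
  refine Eq.trans ?_ (a5 _).symm
  refine Eq.trans ?_ (congrArg _ (a4 _)).symm
  rw [a7, hA, hA, hA]
  exact congrArg (fun u => A u _) cocycle

instance : MonoidalCategoryStruct (HMod k H) where
  tensorObj := tensor
  whiskerLeft V _ _ g := tensorMap (𝟙 V) g
  whiskerRight f W := tensorMap f (𝟙 W)
  tensorHom f g := tensorMap f g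
  tensorUnit := unit k H
  associator := assoc
  leftUnitor := leftUnit
  rightUnitor := rightUnit

instance : MonoidalCategory (HMod k H) := MonoidalCategory.ofTensorHom
  (id_tensorHom_id := fun _ _ => hom_ext TensorProduct.map_id)
  (id_tensorHom := fun _ _ _ _ => rfl)
  (tensorHom_id := fun _ _ => rfl)
  (tensorHom_comp_tensorHom := fun _ _ _ _ => hom_ext (TensorProduct.map_comp _ _ _ _).symm)
  (associator_naturality := fun f g l => hom_ext (LinearMap.ext fun t => assoc_natural f g l t))
  (leftUnitor_naturality := fun f => hom_ext (TensorProduct.ext' fun c v => by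
    exact ((lin f).map_smul c v).symm))
  (rightUnitor_naturality := fun f => hom_ext (TensorProduct.ext' fun v c => by
    exact ((lin f).map_smul c v).symm))
  (pentagon := fun V W X Y => hom_ext (LinearMap.ext fun t => pentagon_aux V W X Y t))
  (triangle := fun V W => hom_ext (LinearMap.ext fun t => triangle_aux V W t))

/-- The conditions on a linear map `β : V → H ⊗ V`, written `β v = ∑ v⁽¹⁾ ⊗ v⁽²⁾`. -/
structure IsCrossed (V : HMod k H) (β : V →ₗ[k] H ⊗[k] V) : Prop where
  /-- `∑ h₁ v⁽¹⁾ ⊗ h₂ ▷ v⁽²⁾ = ∑ (h₁ ▷ v)⁽¹⁾ h₂ ⊗ (h₁ ▷ v)⁽²⁾` -/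
  compat : ∀ (h : H) (v : V),
    tensorAct (regular k H).act V.act (comul h) (β v) =
      twistH β (LinearMap.rTensor H (V.orbit v) (comul h))
  /-- `∑ φ¹ v⁽¹⁾ ⊗ (φ² ▷ v⁽²⁾)⁽¹⁾ φ³ ⊗ (φ² ▷ v⁽²⁾)⁽²⁾ =`
  `φ ▷ ∑ ((φ¹ ▷ v)⁽¹⁾)₁ φ² ⊗ ((φ¹ ▷ v)⁽¹⁾)₂ φ³ ⊗ (φ¹ ▷ v)⁽²⁾`.
  On the left, `φ` acts on `∑ v⁽¹⁾ ⊗ (v⁽²⁾ ⊗ 1)` in `H ⊗ (V ⊗ H)`; on the right,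
  `(φ¹ ▷ v)⁽¹⁾` acts on `φ² ⊗ φ³` in `H ⊗ H` through the coproduct. -/
  quasi_coaction : ∀ v : V,
    LinearMap.lTensor H (twistH β)
      (act₃ (regular k H) V (regular k H) (phiVal k H)
        (TensorProduct.assoc k H V H (β v ⊗ₜ[k] (1 : H)))) =
    act₃ (regular k H) (regular k H) V (phiVal k H)
      (TensorProduct.assoc k H H V
        (twist β (tensor (regular k H) (regular k H))
          (LinearMap.rTensor (H ⊗[k] H) (V.orbit v) (phiVal k H))))
  /-- `∑ ε(v⁽¹⁾) v⁽²⁾ = v` -/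
  counital : ∀ v : V,
    TensorProduct.lid k V (LinearMap.rTensor V (counit (k := k) (H := H)).toLinearMap (β v)) = v

/-- The map `V ⊗ W → H ⊗ (V ⊗ W)` sending `v ⊗ w` to
`φ ▷ ∑ (φ⁻¹ φ¹ ▷ v)⁽¹⁾ φ⁻² (φ² ▷ w)⁽¹⁾ φ³ ⊗ ((φ⁻¹ φ¹ ▷ v)⁽²⁾ ⊗ φ⁻³ ▷ (φ² ▷ w)⁽²⁾)`,
where `φ⁻¹ ⊗ φ⁻² ⊗ φ⁻³` stands for the inverse of `φ`. Reading the steps in order: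
`∑ φ¹ ▷ v ⊗ (φ² ▷ w ⊗ φ³)`, then `∑ φ¹ ▷ v ⊗ ((φ² ▷ w)⁽¹⁾ φ³ ⊗ (φ² ▷ w)⁽²⁾)`, then the action of
the inverse of `φ` on `V ⊗ (H ⊗ W)`, then `β` on the first factor, its `H`-component being
multiplied on the left of the factor in `H`, and finally the action of `φ` on `H ⊗ (V ⊗ W)`. -/
def tensorCoaction {V W : HMod k H} (βV : V →ₗ[k] H ⊗[k] V) (βW : W →ₗ[k] H ⊗[k] W) :
    V ⊗[k] W →ₗ[k] H ⊗[k] (V ⊗[k] W) :=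
  (act₃ (regular k H) V W (phiVal k H) : H ⊗[k] (V ⊗[k] W) →ₗ[k] H ⊗[k] (V ⊗[k] W)) ∘ₗ
    (TensorProduct.assoc k H V W).toLinearMap ∘ₗ
    LinearMap.rTensor W (twistH (H := H) βV) ∘ₗ
    (TensorProduct.assoc k V H W).symm.toLinearMap ∘ₗ
    (act₃ V (regular k H) W (phiInv k H) : V ⊗[k] (H ⊗[k] W) →ₗ[k] V ⊗[k] (H ⊗[k] W)) ∘ₗ
    LinearMap.lTensor V (twistH (H := H) βW) ∘ₗ
    (act₃ V W (regular k H) (phiVal k H) : V ⊗[k] (W ⊗[k] H) →ₗ[k] V ⊗[k] (W ⊗[k] H)) ∘ₗ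
    (TensorProduct.assoc k V W H).toLinearMap ∘ₗ
    (TensorProduct.mk k (V ⊗[k] W) H).flip (1 : H)

/-- The linear map `V → H ⊗ V`, `v ↦ λ (v ⊗ 1)`, obtained from an object `(V, λ)` of the center
through the component of `λ` at the left regular module. -/
def coaction (X : Center (HMod k H)) : X.1 →ₗ[k] H ⊗[k] X.1 :=
  (lin (X.2.β (regular k H)).hom : X.1 ⊗[k] H →ₗ[k] H ⊗[k] X.1) ∘ₗ
    (TensorProduct.mk k X.1 H).flip (1 : H)

end HMod

/-- The component of a half-braiding at the unit object is the identity, up to the unit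
isomorphisms. Hence the objects `(V, λ)` of the center are exactly the natural isomorphisms
`λ_W : V ⊗ W ≅ W ⊗ V` with `λ_1 = id` that satisfy the hexagon identity. -/
theorem halfBraiding_unit {C : Type*} [Category C] [MonoidalCategory C] {X : C}
    (b : HalfBraiding X) : (b.β (𝟙_ C)).hom = (ρ_ X).hom ≫ (λ_ X).inv := by
  have h := b.naturality (λ_ (𝟙_ C)).hom
  rw [b.monoidal] at h
  have h2 : ((b.β (𝟙_ C)).hom ≫ (λ_ X).hom) ▷ 𝟙_ C = (ρ_ X).hom ▷ 𝟙_ C := by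
    rw [← cancel_epi (α_ X (𝟙_ C) (𝟙_ C)).inv, ← cancel_mono (b.β (𝟙_ C)).hom,
      comp_whiskerRight]
    simp only [Category.assoc] at h ⊢
    rw [MonoidalCategory.triangle_assoc_comp_right_assoc, h]
    have e : (α_ (𝟙_ C) X (𝟙_ C)).hom ≫ (λ_ (X ⊗ 𝟙_ C)).hom = (λ_ X).hom ▷ 𝟙_ C := by
      monoidal
    simp [reassoc_of% e]
  rw [Iso.eq_comp_inv]
  exact (MonoidalCategory.whiskerRight_iff _ _).1 h2

end QuasiHopf

/-! ### Half-braidings without invertibility, and when a component is invertible -/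

namespace QuasiHopf

/-! The module `H_L` is free on `1`, so every `w : W` is the image of `1` under the orbit map `H_L ⟶
W`. Naturality along orbit maps forces `λ_W (v ⊗ w) = ∑ v⁽¹⁾ ▷ w ⊗ v⁽²⁾` (`halfBraiding_eq_twist`).
Each axiom on `λ` therefore only has to be tested on `1`'s, where it becomes a condition on `β_V`:
linearity is `compat`, the hexagon is `quasi_coaction`, the unit axiom is `counital`. The statements
on morphisms, tensor products, associator and braiding follow by evaluating at `1` or by unfolding.

The substantial point is that the family built from a crossed pair is invertible. In a rigid
category the inverse comes from duals, but `H_L` need not have one. A substitute is available: let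
`A` be `H` with `h ▷ y = y S(h)`, `L = H_L`, `R` the trivial module `H`, and `B` the adjoint module.
There is a pairing `A ⊗ L ⟶ R`, `y ⊗ x ↦ y α x`, with values in `R` rather than in the unit object,
and a copairing `k ⟶ B`, `1 ↦ β`, where `B` is the quotient of `L ⊗ A` by the relations `x r ⊗ y = x
⊗ r y`. The zigzag `A ⊗ (L ⊗ A) ⟶ A` respects these relations, hence descends to `A ⊗ B`, and the
identity `∑ S(φ⁻¹) α φ⁻² β S(φ⁻³) = 1` says that it is split by the copairing. By counitality the
strand `V` crosses `R` by the flip, which is invertible, so the usual inverse by duality can be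
written down (`LaxHalfBraiding.isIso_hom`) and the component at `A` is invertible. Bijectivity of
`S` makes `S : H_L ⟶ A` an isomorphism, which transfers invertibility to `H_L`; orbit maps then
extend it to all modules (`IsCrossed.twist_bijective`). -/

theorem hexagon_naturality {C : Type*} [Category C] [MonoidalCategory C] {V : C}
    {t : ∀ W : C, V ⊗ W ⟶ W ⊗ V} (ht : ∀ {W Z : C} (f : W ⟶ Z), V ◁ f ≫ t Z = t W ≫ f ▷ V)
    {W W' Z Z' : C} (f : W ⟶ W') (g : Z ⟶ Z') :
    ((V ◁ f) ⊗ₘ g) ≫ t W' ▷ Z' ≫ (α_ W' V Z').hom ≫ W' ◁ t Z' =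
      (t W ▷ Z ≫ (α_ W V Z).hom ≫ W ◁ t Z) ≫ (f ⊗ₘ (g ▷ V)) := by
  simp only [MonoidalCategory.tensorHom_def, Category.assoc]
  rw [whisker_exchange_assoc, ← comp_whiskerRight_assoc, ht, comp_whiskerRight_assoc,
    associator_naturality_right_assoc, ← whiskerLeft_comp, ht, whiskerLeft_comp,
    associator_naturality_left_assoc, ← whisker_exchange_assoc]

/-- A natural family `V ⊗ W ⟶ W ⊗ V` satisfying the hexagon and unit identities of a half-braiding,
but not required to be invertible. -/
structure LaxHalfBraiding {C : Type*} [Category C] [MonoidalCategory C] (V : C) where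
  hom : ∀ W : C, V ⊗ W ⟶ W ⊗ V
  naturality : ∀ {W Z : C} (f : W ⟶ Z), V ◁ f ≫ hom Z = hom W ≫ f ▷ V
  monoidal : ∀ W Z : C, hom (W ⊗ Z) =
    (α_ V W Z).inv ≫ hom W ▷ Z ≫ (α_ W V Z).hom ≫ W ◁ hom Z ≫ (α_ W Z V).inv
  unit : hom (𝟙_ C) = (ρ_ V).hom ≫ (λ_ V).inv

namespace LaxHalfBraiding

variable {C : Type*} [Category C] [MonoidalCategory C] {V A L B R : C} (b : LaxHalfBraiding V)
  (e : V ⊗ R ≅ R ⊗ V) (ev : A ⊗ L ⟶ R) (mu : R ⊗ A ⟶ A)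

/-- The zigzag `A ⊗ (L ⊗ A) ⟶ A` obtained from a pairing `A ⊗ L ⟶ R` and an action of `R` on `A`. -/
def zigzag : A ⊗ (L ⊗ A) ⟶ A := (α_ A L A).inv ≫ ev ▷ A ≫ mu

/-- The action of `R` on `V ⊗ A` induced by the one on `A`. -/
def scalar : R ⊗ (V ⊗ A) ⟶ V ⊗ A :=
  (α_ R V A).inv ≫ e.inv ▷ A ≫ (α_ V R A).hom ≫ V ◁ mu

/-- The zigzag with the strand `V` passing through it. -/
def braidedZigzag : (A ⊗ V) ⊗ (L ⊗ A) ⟶ V ⊗ A :=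
  (α_ A V (L ⊗ A)).hom ≫ A ◁ ((α_ V L A).inv ≫ b.hom L ▷ A ≫ (α_ L V A).hom) ≫
    (α_ A L (V ⊗ A)).inv ≫ ev ▷ (V ⊗ A) ≫ scalar e mu

/-- The endomorphism `r` of `L` passes through the pairing to `r'` on `R`, and then through the
action to `l` on `A`. This is the relation needed to descend from `L ⊗ A` to its balanced quotient.
-/
theorem zigzag_balanced (r : L ⟶ L) (r' : R ⟶ R) (l : A ⟶ A) (h : A ◁ r ≫ ev = ev ≫ r')
    (h' : r' ▷ A ≫ mu = R ◁ l ≫ mu) :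
    A ◁ (r ▷ A) ≫ zigzag ev mu = A ◁ (L ◁ l) ≫ zigzag ev mu := by
  unfold zigzag
  rw [associator_inv_naturality_middle_assoc, ← comp_whiskerRight_assoc, h,
    comp_whiskerRight_assoc, h', associator_inv_naturality_right_assoc, whisker_exchange_assoc]

theorem scalar_balanced (he : e.hom = b.hom R) (r' : R ⟶ R) (l : A ⟶ A)
    (h' : r' ▷ A ≫ mu = R ◁ l ≫ mu) :
    r' ▷ (V ⊗ A) ≫ scalar e mu = R ◁ (V ◁ l) ≫ scalar e mu := by
  have h1 : r' ▷ V ≫ e.inv = e.inv ≫ V ◁ r' := by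
    rw [Iso.comp_inv_eq, Category.assoc, he, b.naturality, ← he, Iso.inv_hom_id_assoc]
  unfold scalar
  rw [associator_inv_naturality_left_assoc, ← comp_whiskerRight_assoc, h1,
    comp_whiskerRight_assoc, associator_naturality_middle_assoc, ← whiskerLeft_comp, h',
    whiskerLeft_comp, associator_inv_naturality_right_assoc, whisker_exchange_assoc,
    associator_naturality_right_assoc]

theorem braidedZigzag_balanced (he : e.hom = b.hom R) (r : L ⟶ L) (r' : R ⟶ R) (l : A ⟶ A)
    (h : A ◁ r ≫ ev = ev ≫ r') (h' : r' ▷ A ≫ mu = R ◁ l ≫ mu) :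
    (A ⊗ V) ◁ (r ▷ A) ≫ b.braidedZigzag e ev mu =
      (A ⊗ V) ◁ (L ◁ l) ≫ b.braidedZigzag e ev mu := by
  have h1 : V ◁ (r ▷ A) ≫ (α_ V L A).inv ≫ b.hom L ▷ A ≫ (α_ L V A).hom =
      ((α_ V L A).inv ≫ b.hom L ▷ A ≫ (α_ L V A).hom) ≫ r ▷ (V ⊗ A) := by
    rw [associator_inv_naturality_middle_assoc, ← comp_whiskerRight_assoc, b.naturality]
    simp
  have h2 : V ◁ (L ◁ l) ≫ (α_ V L A).inv ≫ b.hom L ▷ A ≫ (α_ L V A).hom =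
      ((α_ V L A).inv ≫ b.hom L ▷ A ≫ (α_ L V A).hom) ≫ L ◁ (V ◁ l) := by
    rw [associator_inv_naturality_right_assoc, whisker_exchange_assoc]
    simp
  unfold braidedZigzag
  rw [associator_naturality_right_assoc, associator_naturality_right_assoc,
    ← whiskerLeft_comp_assoc, ← whiskerLeft_comp_assoc, h1, h2, whiskerLeft_comp_assoc _ _ (r ▷ (V ⊗ A)),
    whiskerLeft_comp_assoc _ _ (L ◁ V ◁ l), associator_inv_naturality_middle_assoc,
    associator_inv_naturality_right_assoc, ← comp_whiskerRight_assoc, h, comp_whiskerRight_assoc,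
    b.scalar_balanced e mu he r' l h', whisker_exchange_assoc]

/-- Crossing `A` and then `L` is crossing `A ⊗ L`, by the hexagon. Naturality along `ev` turns this
into crossing `R`, which the factor `e.inv` inside `scalar` undoes. The strand `V` is thus pulled
off the zigzag. -/
theorem hom_braidedZigzag (he : e.hom = b.hom R) :
    b.hom A ▷ (L ⊗ A) ≫ b.braidedZigzag e ev mu =
      (α_ V A (L ⊗ A)).hom ≫ V ◁ zigzag ev mu := by
  have h1 : b.hom A ▷ L ≫ (α_ A V L).hom ≫ A ◁ b.hom L ≫ (α_ A L V).inv ≫ ev ▷ V ≫ e.inv =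
      (α_ V A L).hom ≫ V ◁ ev := by
    have := b.naturality ev
    rw [b.monoidal, ← he] at this
    simp only [Category.assoc] at this
    rw [← cancel_mono e.hom]
    simp [this]
  have h2 := congrArg (fun f => (α_ _ L A).inv ≫ f ▷ A ≫ (α_ V R A).hom ≫ V ◁ mu) h1
  refine Eq.trans ?_ (h2.trans ?_)
  · unfold braidedZigzag scalar
    monoidal
  · unfold zigzag
    monoidal

/-- Naturality along `mu` and the hexagon at `R ⊗ A` make `V` cross `R` and then `A`; the crossing
of `R` cancels `e.inv`. -/
theorem scalar_hom (he : e.hom = b.hom R) :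
    scalar e mu ≫ b.hom A = R ◁ b.hom A ≫ (α_ R A V).inv ≫ mu ▷ V := by
  unfold scalar
  simp only [Category.assoc, b.naturality, b.monoidal, ← he]
  simp

/-- The mirror image of `hom_braidedZigzag`: after `scalar_hom`, the crossings of `L` and of `A`
combine, by the hexagon, into one crossing of `L ⊗ A`. -/
theorem braidedZigzag_hom (he : e.hom = b.hom R) :
    b.braidedZigzag e ev mu ≫ b.hom A =
      (α_ A V (L ⊗ A)).hom ≫ A ◁ b.hom (L ⊗ A) ≫ (α_ A (L ⊗ A) V).inv ≫ zigzag ev mu ▷ V := by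
  unfold braidedZigzag zigzag
  simp only [Category.assoc, b.scalar_hom e mu he, b.monoidal]
  rw [← whisker_exchange_assoc]
  monoidal

/-- If the zigzag through `A ⊗ (L ⊗ A)` descends along `m : L ⊗ A ⟶ B` to a map that is split by
`coev : 𝟙_ C ⟶ B`, then the component of `b` at `A` is invertible. -/
theorem isIso_hom (he : e.hom = b.hom R) (m : L ⊗ A ⟶ B) [Epi ((V ⊗ A) ◁ m)] [Epi ((A ⊗ V) ◁ m)]
    (coev : 𝟙_ C ⟶ B) (z : A ⊗ B ⟶ A) (hz : A ◁ m ≫ z = zigzag ev mu)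
    (hz' : A ◁ coev ≫ z = (ρ_ A).hom) (g : (A ⊗ V) ⊗ B ⟶ V ⊗ A)
    (hg : (A ⊗ V) ◁ m ≫ g = b.braidedZigzag e ev mu) : IsIso (b.hom A) := by
  have h1 : b.hom A ▷ B ≫ g = (α_ V A B).hom ≫ V ◁ z := by
    rw [← cancel_epi ((V ⊗ A) ◁ m), whisker_exchange_assoc, hg, b.hom_braidedZigzag e ev mu he,
      ← hz]
    simp
  have h2 : g ≫ b.hom A = (α_ A V B).hom ≫ A ◁ b.hom B ≫ (α_ A B V).inv ≫ z ▷ V := by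
    rw [← cancel_epi ((A ⊗ V) ◁ m), reassoc_of% hg, b.braidedZigzag_hom e ev mu he, ← hz,
      associator_naturality_right_assoc, ← whiskerLeft_comp_assoc, b.naturality]
    simp
  -- The inverse known from duality: create `B` by `coev`, then close the zigzag with `V` passing
  -- through it. One composite reduces to `z` by `h1`; the other needs `h2`, naturality along `coev`
  -- and the unit axiom.
  refine ⟨(ρ_ (A ⊗ V)).inv ≫ (A ⊗ V) ◁ coev ≫ g, ?_, ?_⟩
  · rw [rightUnitor_inv_naturality_assoc, ← whisker_exchange_assoc, h1,
      associator_naturality_right_assoc, ← whiskerLeft_comp, hz']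
    monoidal
  · simp only [Category.assoc]
    rw [h2, associator_naturality_right_assoc, ← whiskerLeft_comp_assoc, b.naturality, b.unit,
      whiskerLeft_comp_assoc, associator_inv_naturality_middle_assoc, ← comp_whiskerRight, hz']
    monoidal

end LaxHalfBraiding
end QuasiHopf

/-! ### From a crossed pair to a natural family satisfying hexagon and unit axioms -/

namespace QuasiHopf
open QuasiBialgebra
namespace HMod

variable {k H : Type u} [CommRing k] [Ring H] [Algebra k H]

/-- The orbit map as a morphism from the left regular module. -/
def orbitHom (W : HMod k H) (w : W) : regular k H ⟶ W :=
  (⟨W.orbit w, fun (a b : H) => by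
    change W.act ((a : H) * (b : H)) w = W.act a (W.act b w)
    rw [map_mul]; rfl⟩ : Hom (regular k H) W)

theorem orbit_one (W : HMod k H) (w : W) : W.orbit w (1 : H) = w := by simp

theorem orbit_comp {W Z : HMod k H} (f : W ⟶ Z) (w : W) :
    lin f ∘ₗ W.orbit w = Z.orbit (lin f w) :=
  LinearMap.ext fun h => lin_act f h w

theorem orbit_regular_one : (regular k H).orbit (1 : H) = LinearMap.id :=
  LinearMap.ext fun h => mul_one (h : H)

theorem twist_natural {V : HMod k H} (β : V →ₗ[k] H ⊗[k] V) {W Z : HMod k H} (f : W ⟶ Z)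
    (t : V ⊗[k] W) :
    twist β Z (LinearMap.lTensor V (lin f) t) = LinearMap.rTensor V (lin f) (twist β W t) := by
  induction t with
  | zero => simp
  | add s t hs ht => simp only [map_add, hs, ht]
  | tmul v w =>
    rw [LinearMap.lTensor_tmul, twist_tmul, twist_tmul, ← orbit_comp, LinearMap.rTensor_comp]
    rfl

theorem twistH_one {V : HMod k H} (β : V →ₗ[k] H ⊗[k] V) (v : V) :
    twistH β (v ⊗ₜ[k] (1 : H)) = β v := by
  change LinearMap.rTensor V ((regular k H).orbit (1 : H)) (β v) = β v
  rw [orbit_regular_one]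
  exact congrArg (fun u => u (β v)) (LinearMap.rTensor_id V H)

theorem act₃_tmul_one (V : HMod k H) (x : H ⊗[k] (H ⊗[k] H)) (v : V) :
    act₃ V (regular k H) (regular k H) x (v ⊗ₜ[k] ((1 : H) ⊗ₜ[k] (1 : H))) =
      LinearMap.rTensor (H ⊗[k] H) (V.orbit v) x := by
  induction x with
  | zero => simp; rfl
  | add s t hs ht => simp only [map_add, LinearMap.add_apply, hs, ht]; rfl
  | tmul a x =>
    induction x with
    | zero => simp; rfl
    | add s t hs ht => simp only [TensorProduct.tmul_add, map_add, LinearMap.add_apply, hs, ht]; rfl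
    | tmul b c =>
      change V.act a v ⊗ₜ[k] ((b * 1) ⊗ₜ[k] (c * 1)) = _
      rw [mul_one, mul_one]; rfl

/-- The inverse of `v ⊗ w ↦ ∑ v⁽¹⁾ ▷ w ⊗ v⁽²⁾`, given a map `u : H ⊗ V → V ⊗ H` that plays this
role for the left regular module. -/
def twistInv {V : HMod k H} (u : H ⊗[k] V →ₗ[k] V ⊗[k] H) (W : HMod k H) :
    W ⊗[k] V →ₗ[k] V ⊗[k] W :=
  TensorProduct.lift ((LinearMap.lcomp k (V ⊗[k] W) (u ∘ₗ TensorProduct.mk k H V 1)) ∘ₗ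
    LinearMap.lTensorHom V ∘ₗ W.act.toLinearMap.flip)

theorem twistInv_tmul {V : HMod k H} (u : H ⊗[k] V →ₗ[k] V ⊗[k] H) (W : HMod k H) (w : W)
    (v : V) : twistInv u W (w ⊗ₜ[k] v) = LinearMap.lTensor V (W.orbit w) (u ((1 : H) ⊗ₜ[k] v)) := rfl

variable [QuasiBialgebra k H]

theorem tensorAct_comul_tmul_one (V : HMod k H) (h : H) (v : V) :
    tensorAct V.act (regular k H).act (comul h) (v ⊗ₜ[k] (1 : H)) =
      LinearMap.rTensor H (V.orbit v) (comul h) := by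
  induction (comul h : H ⊗[k] H) with
  | zero => simp; rfl
  | add s t hs ht => simp only [map_add, LinearMap.add_apply, hs, ht]; rfl
  | tmul a b => exact congrArg (V.act a v ⊗ₜ[k] ·) (mul_one b)

namespace IsCrossed

variable {V : HMod k H} {β : V →ₗ[k] H ⊗[k] V}

/-- `compat` is linearity at `v ⊗ 1` in `V ⊗ H_L`; the linear map induced by the orbit of `w`
carries it to `v ⊗ w`. -/
theorem twist_act (hβ : IsCrossed V β) (W : HMod k H) (h : H) (t : V ⊗[k] W) :
    twist β W (tensorAct V.act W.act (comul h) t) =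
      tensorAct W.act V.act (comul h) (twist β W t) := by
  induction t with
  | zero => simp
  | add s t hs ht => simp only [map_add, hs, ht]
  | tmul v w =>
    have e1 : LinearMap.lTensor V (W.orbit w) (tensorAct V.act (regular k H).act (comul h)
        (v ⊗ₜ[k] (1 : H))) = tensorAct V.act W.act (comul h) (v ⊗ₜ[k] w) :=
      (lin_act (V ◁ orbitHom W w) h (v ⊗ₜ[k] (1 : H))).trans
        (congrArg (fun u => tensorAct V.act W.act (comul h) (v ⊗ₜ[k] u)) (orbit_one W w))
    have e2 : LinearMap.rTensor V (W.orbit w)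
        (tensorAct (regular k H).act V.act (comul h) (β v)) =
        tensorAct W.act V.act (comul h) (twist β W (v ⊗ₜ[k] w)) :=
      lin_act (orbitHom W w ▷ V) h (β v)
    rw [← e1, ← e2, hβ.compat, ← tensorAct_comul_tmul_one]
    exact twist_natural β (orbitHom W w) _

/-- The natural transformation `v ⊗ w ↦ ∑ v⁽¹⁾ ▷ w ⊗ v⁽²⁾` as a morphism of `H`-modules. -/
def twistHom (hβ : IsCrossed V β) (W : HMod k H) : V ⊗ W ⟶ W ⊗ V :=
  (⟨twist β W, fun h t => hβ.twist_act W h t⟩ : Hom (V ⊗ W) (W ⊗ V))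

theorem lin_twistHom (hβ : IsCrossed V β) (W : HMod k H) :
    lin (hβ.twistHom W) = twist β W := rfl

theorem twistHom_naturality (hβ : IsCrossed V β) {W Z : HMod k H} (f : W ⟶ Z) :
    V ◁ f ≫ hβ.twistHom Z = hβ.twistHom W ≫ f ▷ V :=
  hom_ext (LinearMap.ext fun t => twist_natural β f t)

/-- `quasi_coaction` is this hexagon, once `β v` is read as the image of `v ⊗ 1` and the components
of `φ` as the action of `φ` on `v ⊗ (1 ⊗ 1)`. -/
theorem twistHom_hexagon_regular (hβ : IsCrossed V β) (v : V) :
    lin ((α_ V (regular k H) (regular k H)).hom ≫ hβ.twistHom (regular k H ⊗ regular k H) ≫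
        (α_ (regular k H) (regular k H) V).hom) ((v ⊗ₜ[k] (1 : H)) ⊗ₜ[k] (1 : H)) =
      lin (hβ.twistHom (regular k H) ▷ regular k H ≫ (α_ (regular k H) V (regular k H)).hom ≫
        regular k H ◁ hβ.twistHom (regular k H)) ((v ⊗ₜ[k] (1 : H)) ⊗ₜ[k] (1 : H)) := by
  have e := hβ.quasi_coaction v
  rw [← act₃_tmul_one, ← twistH_one β v] at e
  exact e.symm

theorem twistHom_hexagon (hβ : IsCrossed V β) (W Z : HMod k H) :
    (α_ V W Z).hom ≫ hβ.twistHom (W ⊗ Z) ≫ (α_ W Z V).hom =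
      hβ.twistHom W ▷ Z ≫ (α_ W V Z).hom ≫ W ◁ hβ.twistHom Z := by
  refine hom_ext (TensorProduct.ext_threefold fun v w z => ?_)
  -- Both sides of the hexagon are natural in the two modules, so the orbit maps of `w` and `z`
  -- reduce it to `(v ⊗ 1) ⊗ 1`.
  let f := orbitHom W w
  let g := orbitHom Z z
  have e1 : ((V ◁ f) ⊗ₘ g) ≫ (α_ V W Z).hom ≫ hβ.twistHom (W ⊗ Z) ≫ (α_ W Z V).hom =
      ((α_ V (regular k H) (regular k H)).hom ≫ hβ.twistHom (regular k H ⊗ regular k H) ≫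
        (α_ (regular k H) (regular k H) V).hom) ≫ (f ⊗ₘ (g ▷ V)) := by
    have := hβ.twistHom_naturality (f ⊗ₘ g)
    rw [← id_tensorHom, associator_naturality_assoc, id_tensorHom, reassoc_of% this,
      ← tensorHom_id, associator_naturality, tensorHom_id]
    simp
  have e2 : ((V ◁ f) ⊗ₘ g) ≫ hβ.twistHom W ▷ Z ≫ (α_ W V Z).hom ≫ W ◁ hβ.twistHom Z =
      (hβ.twistHom (regular k H) ▷ regular k H ≫ (α_ (regular k H) V (regular k H)).hom ≫
        regular k H ◁ hβ.twistHom (regular k H)) ≫ (f ⊗ₘ (g ▷ V)) :=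
    hexagon_naturality hβ.twistHom_naturality f g
  have e3 : lin ((V ◁ f) ⊗ₘ g) ((v ⊗ₜ[k] (1 : H)) ⊗ₜ[k] (1 : H)) = (v ⊗ₜ[k] w) ⊗ₜ[k] z := by
    change (v ⊗ₜ[k] W.orbit w (1 : H)) ⊗ₜ[k] Z.orbit z (1 : H) = _
    rw [orbit_one, orbit_one]
  rw [← e3]
  refine (congrArg (fun u => lin u _) e1).trans (Eq.trans ?_ (congrArg (fun u => lin u _) e2).symm)
  exact congrArg (lin (f ⊗ₘ (g ▷ V))) (hβ.twistHom_hexagon_regular v)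

/-- The orbit map of `w` is `h ↦ ε(h) w`, so only `(ε ⊗ id) (β v) = v` enters. It serves both the
unit object and the trivial module on `H`. -/
theorem twist_trivial (hβ : IsCrossed V β) (W : HMod k H)
    (hW : ∀ (h : H) (w : W), W.act h w = counit (k := k) h • w) :
    twist β W = (TensorProduct.comm k V W).toLinearMap := by
  refine TensorProduct.ext' fun v w => ?_
  have e : ∀ x : H ⊗[k] V, LinearMap.rTensor V (W.orbit w) x = w ⊗ₜ[k]
      TensorProduct.lid k V (LinearMap.rTensor V (counit (k := k) (H := H)).toLinearMap x) := by
    intro x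
    induction x with
    | zero => simp
    | add s t hs ht => simp only [map_add, hs, ht, TensorProduct.tmul_add]
    | tmul a v => simp [hW, TensorProduct.smul_tmul]
  rw [twist_tmul, e, hβ.counital]
  rfl

/-- A crossed pair gives a family that satisfies the axioms of a half-braiding except possibly for
invertibility. -/
def laxHalfBraiding (hβ : IsCrossed V β) : LaxHalfBraiding V where
  hom := hβ.twistHom
  naturality := hβ.twistHom_naturality
  monoidal W Z := by
    rw [Iso.eq_inv_comp]
    simp only [← Category.assoc]
    rw [Iso.eq_comp_inv]
    simpa using hβ.twistHom_hexagon W Z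
  unit := hom_ext (by
    have e := hβ.twist_trivial (unit k H) fun _ _ => rfl
    refine (lin_twistHom hβ _).trans (e.trans (TensorProduct.ext' fun v (c : k) => ?_))
    change c ⊗ₜ[k] v = (1 : k) ⊗ₜ[k] (c • v)
    rw [← TensorProduct.smul_tmul, smul_eq_mul, mul_one])

end IsCrossed
end HMod
end QuasiHopf

/-! ### Pairing and copairing from the antipode -/

namespace QuasiHopf
open QuasiBialgebra QuasiHopfAlgebra
namespace HMod

variable {k H : Type u} [CommRing k] [Ring H] [Algebra k H] [QuasiHopfAlgebra k H]

/-- The action of `H` on itself by `h ▷ y = y S(h)`. -/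
def antipodeAct (k H : Type u) [CommRing k] [Ring H] [Algebra k H] [QuasiHopfAlgebra k H] :
    H →ₐ[k] Module.End k H :=
  AlgHom.ofLinearMap ((LinearMap.mul k H).flip ∘ₗ antipode)
    (LinearMap.ext fun y => by simp [antipode_one])
    (fun a b => LinearMap.ext fun y => by simp [antipode_mul, mul_assoc])

theorem antipodeAct_apply (h y : H) : antipodeAct k H h y = y * antipode (k := k) h := rfl

/-- The module `H` with `h ▷ y = y S(h)`. -/
def dualRegular (k H : Type u) [CommRing k] [Ring H] [Algebra k H] [QuasiHopfAlgebra k H] :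
    HMod k H where
  carrier := H
  act := antipodeAct k H

/-- The action of `H ⊗ H` on `H` by `(a ⊗ b) ▷ x = a x S(b)`. -/
def bimoduleAct (k H : Type u) [CommRing k] [Ring H] [Algebra k H] [QuasiHopfAlgebra k H] :
    H ⊗[k] H →ₐ[k] Module.End k H :=
  Algebra.TensorProduct.lift (Algebra.lmul k H) (antipodeAct k H) fun a _ =>
    LinearMap.ext fun x => (mul_assoc a x _).symm

theorem bimoduleAct_tmul (a b x : H) :
    bimoduleAct k H (a ⊗ₜ[k] b) x = a * x * antipode (k := k) b :=
  (mul_assoc a x _).symm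

/-- The adjoint module: `H` with `h ▷ x = ∑ h₁ x S(h₂)`. -/
def adjoint (k H : Type u) [CommRing k] [Ring H] [Algebra k H] [QuasiHopfAlgebra k H] :
    HMod k H where
  carrier := H
  act := (bimoduleAct k H).comp comul

/-- The module `H` with the trivial action `h ▷ x = ε(h) x`. -/
def trivial (k H : Type u) [CommRing k] [Ring H] [Algebra k H] [QuasiBialgebra k H] :
    HMod k H where
  carrier := H
  act := (Algebra.ofId k (Module.End k H)).comp counit

/-- The antipode identifies `H_L` with the module `h ▷ y = y S(h)`. -/
noncomputable def antipodeIso (hS : Function.Bijective (antipode : H →ₗ[k] H)) :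
    regular k H ≅ dualRegular k H :=
  mkIso (V := regular k H) (W := dualRegular k H) (LinearEquiv.ofBijective (antipode : H →ₗ[k] H) hS)
    fun h (x : H) => antipode_mul (k := k) (H := H) h x

theorem mul_tensorAct (s t : H ⊗[k] H) :
    LinearMap.mul' k H (tensorAct (Algebra.lmul k H) (antipodeAct k H) s t) =
      bimoduleAct k H s (LinearMap.mul' k H t) := by
  induction s with
  | zero => simp
  | add x y hx hy => simp only [map_add, LinearMap.add_apply, hx, hy]
  | tmul a b =>
    induction t with
    | zero => simp
    | add x y hx hy => simp only [map_add, hx, hy]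
    | tmul x y => simp [bimoduleAct_tmul, antipodeAct_apply, mul_assoc]

/-- The multiplication `x ⊗ y ↦ x y` from `H_L ⊗ H` to the adjoint module. -/
def mulHom (k H : Type u) [CommRing k] [Ring H] [Algebra k H] [QuasiHopfAlgebra k H] :
    regular k H ⊗ dualRegular k H ⟶ adjoint k H :=
  (⟨LinearMap.mul' k H, fun h t => mul_tensorAct (comul h) t⟩ :
    Hom (regular k H ⊗ dualRegular k H) (adjoint k H))

/-- The linear map `y ⊗ x ↦ y α x`. -/
def pairingLin (k H : Type u) [CommRing k] [Ring H] [Algebra k H] [QuasiHopfAlgebra k H] :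
    H ⊗[k] H →ₗ[k] H :=
  LinearMap.mul' k H ∘ₗ TensorProduct.map (LinearMap.mulRight k (alpha k)) LinearMap.id

theorem pairingLin_tmul (y x : H) : pairingLin k H (y ⊗ₜ[k] x) = y * alpha k * x := rfl

theorem pairingLin_tensorAct (h : H) (t : H ⊗[k] H) :
    pairingLin k H (tensorAct (antipodeAct k H) (Algebra.lmul k H) (comul h) t) =
      counit (k := k) h • pairingLin k H t := by
  induction t with
  | zero => simp
  | add x y hx hy => simp only [map_add, hx, hy, smul_add]
  | tmul y x =>
    have e : ∀ s : H ⊗[k] H,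
        pairingLin k H (tensorAct (antipodeAct k H) (Algebra.lmul k H) s (y ⊗ₜ[k] x)) =
        y * LinearMap.mul' k H (TensorProduct.map
          (LinearMap.mulRight k (alpha k) ∘ₗ antipode) LinearMap.id s) * x := by
      intro s
      induction s with
      | zero => simp
      | add s t hs ht => simp only [map_add, LinearMap.add_apply, hs, ht, mul_add, add_mul]
      | tmul a b => simp [antipodeAct_apply, pairingLin_tmul, mul_assoc]
    rw [e, antipode_alpha, pairingLin_tmul]
    simp

/-- The pairing `y ⊗ x ↦ y α x`. -/
def pairing (k H : Type u) [CommRing k] [Ring H] [Algebra k H] [QuasiHopfAlgebra k H] :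
    dualRegular k H ⊗ regular k H ⟶ trivial k H :=
  (⟨pairingLin k H, fun h t => pairingLin_tensorAct h t⟩ :
    Hom (dualRegular k H ⊗ regular k H) (trivial k H))

theorem mul_tensorAct_trivial (s t : H ⊗[k] H) :
    LinearMap.mul' k H
      (tensorAct ((Algebra.ofId k (Module.End k H)).comp counit) (antipodeAct k H) s t) =
    antipodeAct k H (Algebra.TensorProduct.lid k H
      (Algebra.TensorProduct.map counit (AlgHom.id k H) s)) (LinearMap.mul' k H t) := by
  induction s with
  | zero => simp
  | add s t hs ht => simp only [map_add, LinearMap.add_apply, hs, ht]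
  | tmul a b =>
    induction t with
    | zero => simp
    | add x y hx hy => simp only [map_add, hx, hy]
    | tmul r y =>
      change (counit (k := k) a • r) * (y * antipode (k := k) b) =
        r * y * antipode (k := k) (counit (k := k) a • b)
      simp [mul_assoc]

/-- The multiplication `r ⊗ y ↦ r y`. -/
def trivialMul (k H : Type u) [CommRing k] [Ring H] [Algebra k H] [QuasiHopfAlgebra k H] :
    trivial k H ⊗ dualRegular k H ⟶ dualRegular k H :=
  (⟨LinearMap.mul' k H, fun h t => (mul_tensorAct_trivial (comul h) t).trans
      (congrArg (fun u => antipodeAct k H u (LinearMap.mul' k H t)) (counit_comul h))⟩ :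
    Hom (trivial k H ⊗ dualRegular k H) (dualRegular k H))

theorem bimoduleAct_beta (s : H ⊗[k] H) : bimoduleAct k H s (beta k) = LinearMap.mul' k H
    (TensorProduct.map LinearMap.id (LinearMap.mulLeft k (beta k) ∘ₗ antipode) s) := by
  induction s with
  | zero => simp
  | add s t hs ht => simp only [map_add, LinearMap.add_apply, hs, ht]
  | tmul a b => simp [bimoduleAct_tmul, mul_assoc]

/-- The copairing `1 ↦ β`. -/
def copairing (k H : Type u) [CommRing k] [Ring H] [Algebra k H] [QuasiHopfAlgebra k H] :
    𝟙_ (HMod k H) ⟶ adjoint k H :=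
  (⟨LinearMap.toSpanSingleton k H (beta k), fun h (c : k) => by
    change (counit (k := k) h * c) • beta k = bimoduleAct k H (comul h) (c • beta k)
    rw [map_smul, bimoduleAct_beta, antipode_beta, smul_smul, mul_comm]⟩ :
    Hom (unit k H) (adjoint k H))

/-- Left multiplication by `r` as an endomorphism of the module `h ▷ y = y S(h)`. -/
def dualMulLeft (r : H) : dualRegular k H ⟶ dualRegular k H :=
  (⟨LinearMap.mulLeft k r, fun _ (y : H) => (mul_assoc r (y : H) _).symm⟩ :
    Hom (dualRegular k H) (dualRegular k H))

/-- Right multiplication by `r` as an endomorphism of the trivial module. -/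
def trivialMulRight (r : H) : trivial k H ⟶ trivial k H :=
  (⟨LinearMap.mulRight k r, fun _ (y : H) => smul_mul_assoc (_ : k) (y : H) (r : H)⟩ :
    Hom (trivial k H) (trivial k H))

/-- With `trivialMulRight_trivialMul`, this supplies the balancing hypotheses, for `r` multiplying
on the right of `L` and of `R` and on the left of `A`. -/
theorem orbitHom_pairing (r : H) :
    dualRegular k H ◁ orbitHom (regular k H) r ≫ pairing k H =
      pairing k H ≫ trivialMulRight r :=
  hom_ext (TensorProduct.ext' fun (y x : H) =>
    show (y * alpha k) * (x * r) = ((y * alpha k) * x) * r from (mul_assoc _ _ _).symm)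

theorem trivialMulRight_trivialMul (r : H) :
    trivialMulRight r ▷ dualRegular k H ≫ trivialMul k H =
      trivial k H ◁ dualMulLeft r ≫ trivialMul k H :=
  hom_ext (TensorProduct.ext' fun (s y : H) =>
    show (s * r) * y = s * (r * y) from mul_assoc _ _ _)

theorem whiskerLeft_mulHom_surjective (T : HMod k H) :
    Function.Surjective (lin (T ◁ mulHom k H)) :=
  LinearMap.lTensor_surjective T fun (x : H) => ⟨x ⊗ₜ[k] (1 : H), mul_one x⟩

instance (T : HMod k H) : Epi (T ◁ mulHom k H) where
  left_cancellation f g h := hom_ext (LinearMap.ext fun t => by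
    obtain ⟨s, rfl⟩ := whiskerLeft_mulHom_surjective T t
    exact congrArg (fun u => lin u s) h)

/-- Balanced morphisms out of `T ⊗ (H_L ⊗ H)` factor through the multiplication. -/
theorem exists_factor_mulHom {T M : HMod k H} (f : T ⊗ (regular k H ⊗ dualRegular k H) ⟶ M)
    (hf : ∀ r : H, T ◁ (orbitHom (regular k H) r ▷ dualRegular k H) ≫ f =
      T ◁ (regular k H ◁ dualMulLeft r) ≫ f) :
    ∃ g : T ⊗ adjoint k H ⟶ M, T ◁ mulHom k H ≫ g = f := by
  -- The section `x ↦ x ⊗ 1` of the multiplication is only `k`-linear. Balancing gives `f (t ⊗ (x y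
  -- ⊗ 1)) = f (t ⊗ (x ⊗ y))`, so `g₀` factors `f`; its equivariance then follows from surjectivity
  -- of `T ◁ mulHom k H`.
  let g₀ : T ⊗[k] H →ₗ[k] M :=
    lin f ∘ₗ LinearMap.lTensor T ((TensorProduct.mk k H H).flip (1 : H))
  have e : g₀ ∘ₗ lin (T ◁ mulHom k H) = lin f := by
    refine TensorProduct.ext (LinearMap.ext fun t => TensorProduct.ext' fun (x y : H) => ?_)
    have h := congrArg (fun u => lin u (t ⊗ₜ[k] (x ⊗ₜ[k] (1 : H)))) (hf y)
    exact h.trans (congrArg (fun u : H => lin f (t ⊗ₜ[k] ((x : H) ⊗ₜ[k] (u : H)))) (mul_one y))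
  refine ⟨(⟨g₀, fun h t => ?_⟩ : Hom (T ⊗ adjoint k H) M), hom_ext e⟩
  obtain ⟨s, rfl⟩ := whiskerLeft_mulHom_surjective T t
  have e' := fun s => congrArg (fun u => u s) e
  exact (congrArg g₀ (lin_act (T ◁ mulHom k H) h s)).symm.trans
    ((e' _).trans ((lin_act f h s).trans (congrArg (M.act h) (e' s).symm)))

/-- On `x = p ⊗ (q ⊗ r)` both sides are `y S(p) α q b S(r)`. For `x = φ⁻¹` and `b = β` the factor
after `y` is the antipode identity for `φ⁻¹`. -/
theorem mul_pairing_act₃ (y b : H) (x : H ⊗[k] (H ⊗[k] H)) :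
    LinearMap.mul' k H (LinearMap.rTensor H (pairingLin k H)
      ((TensorProduct.assoc k H H H).symm
        (tensorAct (antipodeAct k H) (tensorAct (Algebra.lmul k H) (antipodeAct k H)) x
          (y ⊗ₜ[k] (b ⊗ₜ[k] (1 : H)))))) =
    y * LinearMap.mul' k H (TensorProduct.map antipode
        (LinearMap.mul' k H ∘ₗ TensorProduct.map
          (LinearMap.mulRight k b ∘ₗ LinearMap.mulLeft k (alpha k)) antipode) x) := by
  induction x with
  | zero => simp
  | add s t hs ht => simp only [map_add, LinearMap.add_apply, hs, ht, mul_add]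
  | tmul p x =>
    induction x with
    | zero => simp
    | add s t hs ht =>
      simp only [map_add, TensorProduct.tmul_add, LinearMap.add_apply, hs, ht, mul_add]
    | tmul q r => simp [antipodeAct_apply, pairingLin_tmul, mul_assoc]

theorem zigzag_beta (y : H) :
    lin (LaxHalfBraiding.zigzag (pairing k H) (trivialMul k H))
      (y ⊗ₜ[k] ((beta k : H) ⊗ₜ[k] (1 : H))) = y :=
  (mul_pairing_act₃ y (beta k) (phiInv k H)).trans (by rw [antipode_phi_inv, mul_one])

/-- The zigzag identity for the pairing and the copairing. -/
theorem copairing_zigzag {z : dualRegular k H ⊗ adjoint k H ⟶ dualRegular k H}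
    (hz : dualRegular k H ◁ mulHom k H ≫ z =
      LaxHalfBraiding.zigzag (pairing k H) (trivialMul k H)) :
    dualRegular k H ◁ copairing k H ≫ z = (ρ_ (dualRegular k H)).hom := by
  refine hom_ext (TensorProduct.ext' fun (y : H) (c : k) => ?_)
  let z₀ : H ⊗[k] H →ₗ[k] H := lin z
  -- `β ⊗ 1` is a lift of `β` through the multiplication, so `z` can be evaluated there by the
  -- undescended zigzag.
  have h1 : LinearMap.lTensor H (LinearMap.mul' k H) (y ⊗ₜ[k] ((beta k : H) ⊗ₜ[k] (1 : H))) =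
      y ⊗ₜ[k] beta k := by simp
  have h2 : lin (dualRegular k H ◁ mulHom k H ≫ z) (y ⊗ₜ[k] ((beta k : H) ⊗ₜ[k] (1 : H))) = y := by
    rw [hz]
    exact zigzag_beta y
  have h : z₀ (y ⊗ₜ[k] beta k) = y := by
    rw [← h1]
    exact h2
  change z₀ (y ⊗ₜ[k] (c • (beta k : H))) = c • y
  rw [TensorProduct.tmul_smul, map_smul, h]

/-! ### Invertibility of the family of a crossed pair -/

namespace IsCrossed

variable {V : HMod k H} {β : V →ₗ[k] H ⊗[k] V}

/-- On a trivial module, the family of a crossed pair is the flip. -/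
def twistTrivialIso (hβ : IsCrossed V β) : V ⊗ trivial k H ≅ trivial k H ⊗ V :=
  have e : twist β (trivial k H) = (TensorProduct.comm k V H).toLinearMap :=
    hβ.twist_trivial (trivial k H) fun _ _ => rfl
  mkIso (V := V ⊗ trivial k H) (W := trivial k H ⊗ V) (TensorProduct.comm k V H) fun h t =>
    (congrArg (fun u => u (tensorAct V.act (trivial k H).act (comul h) t)) e).symm.trans
      ((hβ.twist_act (trivial k H) h t).trans
        (congrArg (fun u => tensorAct (trivial k H).act V.act (comul h) (u t)) e))

theorem twistTrivialIso_hom (hβ : IsCrossed V β) :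
    hβ.twistTrivialIso.hom = hβ.laxHalfBraiding.hom (trivial k H) :=
  hom_ext (hβ.twist_trivial (trivial k H) fun _ _ => rfl).symm

theorem isIso_twistHom_dualRegular (hβ : IsCrossed V β) :
    IsIso (hβ.twistHom (dualRegular k H)) := by
  obtain ⟨z, hz⟩ := exists_factor_mulHom
    (LaxHalfBraiding.zigzag (pairing k H) (trivialMul k H)) fun r =>
      LaxHalfBraiding.zigzag_balanced _ _ _ _ _ (orbitHom_pairing r) (trivialMulRight_trivialMul r)
  obtain ⟨g, hg⟩ := exists_factor_mulHom
    (hβ.laxHalfBraiding.braidedZigzag hβ.twistTrivialIso (pairing k H) (trivialMul k H)) fun r =>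
      LaxHalfBraiding.braidedZigzag_balanced _ _ _ _ hβ.twistTrivialIso_hom _ _ _
        (orbitHom_pairing r) (trivialMulRight_trivialMul r)
  exact hβ.laxHalfBraiding.isIso_hom hβ.twistTrivialIso (pairing k H) (trivialMul k H)
    hβ.twistTrivialIso_hom (mulHom k H) (copairing k H) z hz (copairing_zigzag hz) g hg

theorem isIso_twistHom_regular (hβ : IsCrossed V β)
    (hS : Function.Bijective (antipode : H →ₗ[k] H)) : IsIso (hβ.twistHom (regular k H)) := by
  have := hβ.isIso_twistHom_dualRegular
  have h := hβ.twistHom_naturality (antipodeIso hS).hom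
  have e : hβ.twistHom (regular k H) = (V ◁ (antipodeIso hS).hom ≫
      hβ.twistHom (dualRegular k H)) ≫ (antipodeIso hS).inv ▷ V := by
    rw [h, Category.assoc, ← comp_whiskerRight, Iso.hom_inv_id, id_whiskerRight, Category.comp_id]
  rw [e]
  infer_instance

theorem twist_bijective (hβ : IsCrossed V β)
    (hS : Function.Bijective (antipode : H →ₗ[k] H)) (W : HMod k H) :
    Function.Bijective (twist β W) := by
  have := hβ.isIso_twistHom_regular hS
  let u : H ⊗[k] V →ₗ[k] V ⊗[k] H := lin (inv (hβ.twistHom (regular k H)))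
  have hu : ∀ t, twistH β (u t) = t := fun t =>
    congrArg (fun f => lin f t) (IsIso.inv_hom_id (hβ.twistHom (regular k H)))
  have hu' : ∀ t, u (twistH β t) = t := fun t =>
    congrArg (fun f => lin f t) (IsIso.hom_inv_id (hβ.twistHom (regular k H)))
  -- Right multiplications are the orbit maps of `H_L`; `u` commutes with them because its inverse
  -- does.
  have hr : ∀ (x : H) (t : H ⊗[k] V), u (LinearMap.rTensor V (LinearMap.mulRight k x) t) =
      LinearMap.lTensor V (LinearMap.mulRight k x) (u t) := fun x t => by
    conv_lhs => rw [← hu t]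
    refine Eq.trans (congrArg u ?_) (hu' _)
    exact (twist_natural β (orbitHom (regular k H) x) (u t)).symm
  have h1 : ∀ t, twist β W (twistInv u W t) = t := by
    intro t
    induction t with
    | zero => simp
    | add s t hs ht => simp only [map_add, hs, ht]
    | tmul w v =>
      rw [twistInv_tmul]
      refine (twist_natural β (orbitHom W w) _).trans ((congrArg _ (hu _)).trans ?_)
      exact congrArg (· ⊗ₜ[k] v) (orbit_one W w)
  have h2 : ∀ t, twistInv u W (twist β W t) = t := by
    intro t
    induction t with
    | zero => simp
    | add s t hs ht => simp only [map_add, hs, ht]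
    | tmul v w =>
      -- Naturality of `twistInv` along the orbit map of `w`, which rests on `hr`. At `s = β v`, the
      -- image of `v ⊗ 1`, the map `u` returns `v ⊗ 1`.
      have e : ∀ s : H ⊗[k] V, twistInv u W (LinearMap.rTensor V (W.orbit w) s) =
          LinearMap.lTensor V (W.orbit w) (u s) := by
        intro s
        induction s with
        | zero => simp
        | add s t hs ht => simp only [map_add, hs, ht]
        | tmul x v =>
          have e1 : W.orbit (W.orbit w x) = W.orbit w ∘ₗ LinearMap.mulRight k x :=
            LinearMap.ext fun a => (congrArg (fun f => f w) (map_mul W.act a x)).symm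
          rw [LinearMap.rTensor_tmul, twistInv_tmul, e1, LinearMap.lTensor_comp,
            LinearMap.comp_apply, ← hr]
          simp
      rw [twist_tmul, e, ← twistH_one β v, hu']
      exact congrArg (v ⊗ₜ[k] ·) (orbit_one W w)
  exact Function.bijective_iff_has_inverse.2 ⟨twistInv u W, h2, h1⟩

end IsCrossed
end HMod
end QuasiHopf

/-! ### The center in terms of coactions -/

namespace QuasiHopf
open QuasiBialgebra QuasiHopfAlgebra
namespace HMod

variable {k H : Type u} [CommRing k] [Ring H] [Algebra k H]

section Center

variable [QuasiBialgebra k H]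

/-- The half-braiding of an object of the center is determined by its coaction. -/
theorem halfBraiding_eq_twist (X : Center (HMod k H)) (W : HMod k H) :
    lin (X.2.β W).hom = twist (coaction X) W := by
  refine TensorProduct.ext' fun v w => ?_
  have h := congrArg (fun u => lin u (v ⊗ₜ[k] (1 : H))) (X.2.naturality (orbitHom W w))
  exact (congrArg (fun u => lin (X.2.β W).hom (v ⊗ₜ[k] u)) (orbit_one W w)).symm.trans h

/-- The three conditions are linearity of `λ_{H_L}` at `v ⊗ 1`, the hexagon for `H_L, H_L` at `(v ⊗
1) ⊗ 1`, and `halfBraiding_unit` at `v ⊗ 1`, since the orbit map of `1` in the unit object is `ε`.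
-/
theorem isCrossed_coaction (X : Center (HMod k H)) : IsCrossed X.1 (coaction X) where
  compat h v := by
    have e := lin_act (X.2.β (regular k H)).hom h (v ⊗ₜ[k] (1 : H))
    rw [← tensorAct_comul_tmul_one, twistH, ← halfBraiding_eq_twist]
    exact e.symm
  quasi_coaction v := by
    have e : (X.2.β (regular k H)).hom ▷ regular k H ≫ (α_ (regular k H) X.1 (regular k H)).hom ≫
        regular k H ◁ (X.2.β (regular k H)).hom =
        (α_ X.1 (regular k H) (regular k H)).hom ≫ (X.2.β (regular k H ⊗ regular k H)).hom ≫
        (α_ (regular k H) (regular k H) X.1).hom := by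
      rw [X.2.monoidal]; simp
    have e' := congrArg (fun u => lin u ((v ⊗ₜ[k] (1 : H)) ⊗ₜ[k] (1 : H))) e
    rw [← act₃_tmul_one, twistH, ← halfBraiding_eq_twist, ← halfBraiding_eq_twist]
    exact e'
  counital v := by
    have e := congrArg (fun u => lin u (v ⊗ₜ[k] (1 : k))) (halfBraiding_unit X.2)
    have e1 : lin (X.2.β (𝟙_ (HMod k H))).hom (v ⊗ₜ[k] (1 : k)) =
        LinearMap.rTensor X.1 (counit (k := k) (H := H)).toLinearMap (coaction X v) := by
      rw [halfBraiding_eq_twist]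
      have : (unit k H).orbit (1 : k) = (counit (k := k) (H := H)).toLinearMap :=
        LinearMap.ext fun h => mul_one (counit (k := k) h)
      exact congrArg (fun u => LinearMap.rTensor X.1 u (coaction X v)) this
    have e2 := e1.symm.trans e
    refine (congrArg (TensorProduct.lid k X.1) e2).trans ?_
    change (1 : k) • ((1 : k) • v) = v
    simp

theorem coaction_injective {X Y : Center (HMod k H)}
    (h : (⟨X.1, coaction X⟩ : Σ V : HMod k H, V →ₗ[k] H ⊗[k] V) = ⟨Y.1, coaction Y⟩) : X = Y := by
  have hX := halfBraiding_eq_twist X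
  have hY := halfBraiding_eq_twist Y
  obtain ⟨V, b⟩ := X
  obtain ⟨V', b'⟩ := Y
  obtain rfl : V = V' := congrArg Sigma.fst h
  have hc := eq_of_heq (Sigma.mk.inj h).2
  have e : b.β = b'.β := funext fun W => Iso.ext (hom_ext ((hX W).trans
    ((congrArg (fun u => twist u W) hc).trans (hY W).symm)))
  obtain ⟨β, _, _⟩ := b
  obtain ⟨β', _, _⟩ := b'
  obtain rfl : β = β' := e
  rfl

/-- `tensorCoaction` lists the factors of the half-braiding of `X ⊗ Y` at `H_L`, evaluated at `(v ⊗
w) ⊗ 1`. -/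
theorem coaction_tensor (X Y : Center (HMod k H)) :
    coaction (X ⊗ Y) = tensorCoaction (coaction X) (coaction Y) := by
  have hX : lin (X.2.β (regular k H)).hom = twistH (coaction X) := halfBraiding_eq_twist X _
  have hY : lin (Y.2.β (regular k H)).hom = twistH (coaction Y) := halfBraiding_eq_twist Y _
  rw [tensorCoaction, ← hX, ← hY]
  rfl

/-- The morphisms of the center are the module maps that intertwine the coactions. -/
theorem intertwines_iff {X Y : Center (HMod k H)} (g : X.1 ⟶ Y.1) :
    (∀ W, g ▷ W ≫ (Y.2.β W).hom = (X.2.β W).hom ≫ W ◁ g) ↔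
      ∀ v : X.1, LinearMap.lTensor H (lin g) (coaction X v) = coaction Y (lin g v) := by
  constructor
  · intro h v
    exact (congrArg (fun u => lin u (v ⊗ₜ[k] (1 : H))) (h (regular k H))).symm
  · intro h W
    refine hom_ext (TensorProduct.ext' fun v w => ?_)
    have e1 : lin (Y.2.β W).hom (lin g v ⊗ₜ[k] w) =
        LinearMap.rTensor Y.1 (W.orbit w) (coaction Y (lin g v)) := by
      rw [halfBraiding_eq_twist]; rfl
    have e2 : lin (X.2.β W).hom (v ⊗ₜ[k] w) =
        LinearMap.rTensor X.1 (W.orbit w) (coaction X v) := by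
      rw [halfBraiding_eq_twist]; rfl
    refine e1.trans (Eq.trans ?_ (congrArg (LinearMap.lTensor W (lin g)) e2).symm)
    rw [← h]
    -- The orbit map acts on the `H` factor and `g` on the module factor, so they commute.
    exact LinearMap.congr_fun ((LinearMap.rTensor_comp_lTensor _ _ _).trans
      (LinearMap.lTensor_comp_rTensor _ _ _).symm) (coaction X v)

end Center

variable [QuasiHopfAlgebra k H]

/-- The object of the center attached to a crossed pair. -/
noncomputable def IsCrossed.toCenter {V : HMod k H} {β : V →ₗ[k] H ⊗[k] V} (hβ : IsCrossed V β)
    (hS : Function.Bijective (antipode : H →ₗ[k] H)) : Center (HMod k H) :=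
  ⟨V,
    { β := fun W => mkIso (V := V ⊗ W) (W := W ⊗ V)
        (LinearEquiv.ofBijective (twist β W) (hβ.twist_bijective hS W)) (hβ.twist_act W)
      monoidal := hβ.laxHalfBraiding.monoidal
      naturality := hβ.laxHalfBraiding.naturality }⟩

theorem IsCrossed.coaction_toCenter {V : HMod k H} {β : V →ₗ[k] H ⊗[k] V} (hβ : IsCrossed V β)
    (hS : Function.Bijective (antipode : H →ₗ[k] H)) : coaction (hβ.toCenter hS) = β :=
  LinearMap.ext fun v => twistH_one β v

end HMod
end QuasiHopf

theorem proposition2p2 (k H : Type u) [CommRing k] [Ring H] [Algebra k H]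
    [QuasiHopf.QuasiHopfAlgebra k H]
    (hS : Function.Bijective (QuasiHopf.QuasiHopfAlgebra.antipode : H →ₗ[k] H)) :
    -- objects: `(V, λ) ↦ (V, β)` with `β v = λ (v ⊗ 1)` is a bijection onto the crossed pairs
    Set.BijOn
      (fun X : Center (QuasiHopf.HMod k H) =>
        (⟨X.1, QuasiHopf.HMod.coaction X⟩ : Σ V : QuasiHopf.HMod k H, V →ₗ[k] H ⊗[k] V))
      Set.univ {p | QuasiHopf.HMod.IsCrossed p.1 p.2} ∧
    -- `λ` is recovered from `β` by `λ (v ⊗ w) = ∑ v⁽¹⁾ ▷ w ⊗ v⁽²⁾`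
    (∀ (X : Center (QuasiHopf.HMod k H)) (W : QuasiHopf.HMod k H) (v : X.1) (w : W),
      QuasiHopf.HMod.lin (X.2.β W).hom (v ⊗ₜ[k] w) =
        LinearMap.rTensor X.1 (W.orbit w) (QuasiHopf.HMod.coaction X v)) ∧
    -- morphisms: the `H`-module maps that intertwine the maps `β`
    (∀ X Y : Center (QuasiHopf.HMod k H),
      Set.BijOn (fun f : X ⟶ Y => Center.Hom.f f) Set.univ
        {g : X.1 ⟶ Y.1 | ∀ v : X.1,
          LinearMap.lTensor H (QuasiHopf.HMod.lin g) (QuasiHopf.HMod.coaction X v) =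
            QuasiHopf.HMod.coaction Y (QuasiHopf.HMod.lin g v)}) ∧
    -- tensor products
    (∀ X Y : Center (QuasiHopf.HMod k H),
      (X ⊗ Y).1 = QuasiHopf.HMod.tensor X.1 Y.1 ∧
      QuasiHopf.HMod.coaction (X ⊗ Y) =
        QuasiHopf.HMod.tensorCoaction (QuasiHopf.HMod.coaction X) (QuasiHopf.HMod.coaction Y)) ∧
    -- associativity isomorphisms
    (∀ (X Y Z : Center (QuasiHopf.HMod k H)) (x : X.1) (y : Y.1) (z : Z.1),
      QuasiHopf.HMod.lin (Center.Hom.f (α_ X Y Z).hom) ((x ⊗ₜ[k] y) ⊗ₜ[k] z) =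
        QuasiHopf.HMod.act₃ X.1 Y.1 Z.1 (QuasiHopf.phiVal k H) (x ⊗ₜ[k] (y ⊗ₜ[k] z))) ∧
    -- braiding
    (∀ (X Y : Center (QuasiHopf.HMod k H)) (v : X.1) (w : Y.1),
      QuasiHopf.HMod.lin (Center.Hom.f (β_ X Y).hom) (v ⊗ₜ[k] w) =
        LinearMap.rTensor X.1 (Y.1.orbit w) (QuasiHopf.HMod.coaction X v)) := by
  refine ⟨⟨fun X _ => QuasiHopf.HMod.isCrossed_coaction X,
      fun X _ Y _ h => QuasiHopf.HMod.coaction_injective h,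
      fun p hp => ⟨QuasiHopf.HMod.IsCrossed.toCenter hp hS, trivial,
        Sigma.ext rfl (heq_of_eq (QuasiHopf.HMod.IsCrossed.coaction_toCenter hp hS))⟩⟩,
    fun X W v w => congrArg (fun u => u (v ⊗ₜ[k] w)) (QuasiHopf.HMod.halfBraiding_eq_twist X W),
    fun X Y => ⟨fun f _ => (QuasiHopf.HMod.intertwines_iff f.f).1 f.comm,
      fun f _ g _ h => Center.Hom.ext h,
      fun g hg => ⟨⟨g, (QuasiHopf.HMod.intertwines_iff g).2 hg⟩, trivial, rfl⟩⟩,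
    fun X Y => ⟨rfl, QuasiHopf.HMod.coaction_tensor X Y⟩,
    fun X Y Z x y z => rfl,
    fun X Y v w =>
      congrArg (fun u => u (v ⊗ₜ[k] w)) (QuasiHopf.HMod.halfBraiding_eq_twist X Y.1)⟩
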